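/- **Theorem.** There is a deterministic fully polynomial-time approximation scheme (FPTAS) for the statistical similarity $S(P,Q)=\sum_{x\in[\ell]^n}\min(P(x),Q(x))$ of two product distributions $P=P_1\otimes\dots\otimes P_n$ and $Q=Q_1\otimes\dots\otimes Q_n$ over $[\ell]^n$ ($n\ge 1$), given by their marginal distributions $P_i,Q_i$ on $[\ell]$, whose probabilities are rational numbers. Precisely, there is one deterministic algorithm (a program of a random access machine over the natural numbers with the operations $+$, truncated subtraction, $\times$, integer division, tests for zero and indirect addressing) which, for all $n\ge1$ and $\ell$, all such $P,Q$ and every rational $\varepsilon>0$, the probabilities $P_i(x),Q_i(x)$ and $\varepsilon$ being given as fractions in lowest terms with numerators and denominators in binary, halts and outputs a fraction whose value lies in the interval $$\left[\frac{S(P,Q)}{1+\varepsilon},\ (1+\varepsilon)\,S(P,Q)\right],$$ and whose running time satisfies both of the following bounds. 1. Its bit cost (every operation being charged the binary length of the numbers it handles) is bounded by a fixed polynomial in $L$ and $1/\varepsilon$, where $L$ is the total binary length of the input. 2. It performs at most $\widetilde O\!\left(\dfrac{n^3\,\ell\,\log_2\!\big((1+\varepsilon')/(\varepsilon'\tau)\big)}{\varepsilon'}\right)$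 elementary operations, where $\varepsilon'=\min(\varepsilon,1)$ (so $\varepsilon'=\varepsilon$ for $\varepsilon\le1$) and $\tau>0$ is any lower bound on all the nonzero probabilities among the $P_i(x)$ and $Q_i(x)$. Here $\widetilde O(F)$ means at most $C\,F\,(1+\log_2F)^k$ with absolute constants $C,k$. -/

import Mathlib

/-- The statistical similarity `S(P, Q) = ∑ₓ min (P x, Q x)` of two (rational) mass functions on a
finite sample space. -/
def statSim {α : Type*} [Fintype α] (P Q : α → ℚ≥0) : ℚ≥0 := ∑ x, min (P x) (Q x)

/-- The mass function on `[ℓ]ⁿ` of the product distribution with marginals `p 0, …, p (n-1)`. -/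
def productDist {n ℓ : ℕ} (p : Fin n → Fin ℓ → ℚ≥0) : (Fin n → Fin ℓ) → ℚ≥0 :=
  fun y => ∏ i, p i (y i)

/-! ### The machine model: a random access machine, programmed by structured programs

The memory consists of scalar variables and arrays, all of whose cells hold natural numbers.
Since a program is a finite object, it names only finitely many variables and arrays; array cells
are addressed by computed values (indirect addressing).  Two costs are attached to an execution:
the number of elementary operations (unit cost), and the number of bit operations, where each
operation is charged the binary length of the numbers it handles (logarithmic cost). -/

namespace RAM

/-- Memory contents. -/
structure Store where
  /-- the scalar variables -/
  var : ℕ → ℕ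
  /-- `arr a j` is the cell number `j` of the array `a` -/
  arr : ℕ → ℕ → ℕ

/-- Arithmetic expressions. -/
inductive Expr where
  | const (c : ℕ)
  | var (v : ℕ)
  | read (a : ℕ) (index : Expr)
  | add (e₁ e₂ : Expr)
  | sub (e₁ e₂ : Expr)
  | mul (e₁ e₂ : Expr)
  | div (e₁ e₂ : Expr)

namespace Expr

/-- The value of an expression; subtraction is truncated at `0`, division is integer division
(with value `0` if the divisor is `0`). -/
def eval (s : Store) : Expr → ℕ
  | const c => c
  | var v => s.var v
  | read a e => s.arr a (e.eval s)
  | add e₁ e₂ => e₁.eval s + e₂.eval s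
  | sub e₁ e₂ => e₁.eval s - e₂.eval s
  | mul e₁ e₂ => e₁.eval s * e₂.eval s
  | div e₁ e₂ => e₁.eval s / e₂.eval s

/-- The number of elementary operations in the evaluation of an expression (every node is one). -/
def ops : Expr → ℕ
  | const _ => 1
  | var _ => 1
  | read _ e => e.ops + 1
  | add e₁ e₂ => e₁.ops + e₂.ops + 1
  | sub e₁ e₂ => e₁.ops + e₂.ops + 1
  | mul e₁ e₂ => e₁.ops + e₂.ops + 1
  | div e₁ e₂ => e₁.ops + e₂.ops + 1

/-- The logarithmic cost of the evaluation of an expression: every node is charged one more than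
the binary length of its value. The operands and the addresses are nodes themselves, so their
lengths are charged, too. -/
def bits (s : Store) : Expr → ℕ
  | const c => c.size + 1
  | var v => (s.var v).size + 1
  | read a e => e.bits s + ((read a e).eval s).size + 1
  | add e₁ e₂ => e₁.bits s + e₂.bits s + ((add e₁ e₂).eval s).size + 1
  | sub e₁ e₂ => e₁.bits s + e₂.bits s + ((sub e₁ e₂).eval s).size + 1
  | mul e₁ e₂ => e₁.bits s + e₂.bits s + ((mul e₁ e₂).eval s).size + 1
  | div e₁ e₂ => e₁.bits s + e₂.bits s + ((div e₁ e₂).eval s).size + 1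

end Expr

/-- Programs. -/
inductive Cmd where
  | skip
  | assign (v : ℕ) (e : Expr)
  | write (a : ℕ) (index value : Expr)
  | seq (c₁ c₂ : Cmd)
  | ite (test : Expr) (c₁ c₂ : Cmd)
  | loop (test : Expr) (body : Cmd)

/-- `Exec c s s' t b`: started in the memory `s`, the program `c` halts, in the memory `s'`, after
`t` elementary operations of total logarithmic cost `b`. A test succeeds if its value is not `0`;
`loop` repeats its body as long as the test succeeds. -/
inductive Exec : Cmd → Store → Store → ℕ → ℕ → Prop where
  | skip (s : Store) : Exec .skip s s 1 1
  | assign (s : Store) (v : ℕ) (e : Expr) :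
      Exec (.assign v e) s { s with var := Function.update s.var v (e.eval s) }
        (e.ops + 1) (e.bits s + 1)
  | write (s : Store) (a : ℕ) (i e : Expr) :
      Exec (.write a i e) s
        { s with arr := Function.update s.arr a
                          (Function.update (s.arr a) (i.eval s) (e.eval s)) }
        (i.ops + e.ops + 1) (i.bits s + e.bits s + 1)
  | seq {c₁ c₂ : Cmd} {s₁ s₂ s₃ : Store} {t₁ b₁ t₂ b₂ : ℕ} :
      Exec c₁ s₁ s₂ t₁ b₁ → Exec c₂ s₂ s₃ t₂ b₂ →
      Exec (.seq c₁ c₂) s₁ s₃ (t₁ + t₂) (b₁ + b₂)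
  | ite_true {e : Expr} {c₁ c₂ : Cmd} {s s' : Store} {t b : ℕ} :
      e.eval s ≠ 0 → Exec c₁ s s' t b →
      Exec (.ite e c₁ c₂) s s' (e.ops + 1 + t) (e.bits s + 1 + b)
  | ite_false {e : Expr} {c₁ c₂ : Cmd} {s s' : Store} {t b : ℕ} :
      e.eval s = 0 → Exec c₂ s s' t b →
      Exec (.ite e c₁ c₂) s s' (e.ops + 1 + t) (e.bits s + 1 + b)
  | loop_false {e : Expr} {c : Cmd} {s : Store} :
      e.eval s = 0 → Exec (.loop e c) s s (e.ops + 1) (e.bits s + 1)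
  | loop_true {e : Expr} {c : Cmd} {s₁ s₂ s₃ : Store} {t₁ b₁ t₂ b₂ : ℕ} :
      e.eval s₁ ≠ 0 → Exec c s₁ s₂ t₁ b₁ → Exec (.loop e c) s₂ s₃ t₂ b₂ →
      Exec (.loop e c) s₁ s₃ (e.ops + 1 + t₁ + t₂) (e.bits s₁ + 1 + b₁ + b₂)

/-- Programs are deterministic: the final memory and both costs are determined by the program and
the initial memory. -/
theorem Exec.deterministic {c : Cmd} {s s₁ s₂ : Store} {t₁ b₁ t₂ b₂ : ℕ}
    (h₁ : Exec c s s₁ t₁ b₁) (h₂ : Exec c s s₂ t₂ b₂) : s₁ = s₂ ∧ t₁ = t₂ ∧ b₁ = b₂ := by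
  induction h₁ generalizing s₂ t₂ b₂ with
  | skip | assign | write => cases h₂; simp
  | seq _ _ ih ih' =>
    cases h₂ with
    | seq a b =>
      obtain ⟨rfl, rfl, rfl⟩ := ih a
      obtain ⟨rfl, rfl, rfl⟩ := ih' b
      simp
  | ite_true h _ ih | ite_false h _ ih =>
    cases h₂ with
    | ite_true h' a | ite_false h' a =>
      first
      | exact absurd h' h
      | exact absurd h h'
      | obtain ⟨rfl, rfl, rfl⟩ := ih a
        simp
  | loop_false h =>
    cases h₂ with
    | loop_false _ => simp
    | loop_true h' _ _ => exact absurd h h'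
  | loop_true h _ _ ih ih' =>
    cases h₂ with
    | loop_false h' => exact absurd h' h
    | loop_true _ a b =>
      obtain ⟨rfl, rfl, rfl⟩ := ih a
      obtain ⟨rfl, rfl, rfl⟩ := ih' b
      simp

end RAM

/-! ### The input and its length -/

/-- An `n × ℓ` table of numbers as an array, row by row: the entry `(i, x)` is in cell `ℓ * i + x`;
the remaining cells are `0`. -/
def flatten {n ℓ : ℕ} (g : Fin n → Fin ℓ → ℕ) (k : ℕ) : ℕ :=
  if h : k < n * ℓ then
    g (finProdFinEquiv.symm ⟨k, h⟩).1 (finProdFinEquiv.symm ⟨k, h⟩).2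
  else 0

/-- The initial memory: variables `0, 1, 2, 3` hold `n`, `ℓ` and the numerator and denominator of
`ε`; arrays `0, 1` hold the numerators and denominators of the marginal probabilities `P i x`, and
arrays `2, 3` those of the `Q i x` (in lowest terms). Everything else is `0`. -/
def inputStore {n ℓ : ℕ} (P Q : Fin n → Fin ℓ → ℚ≥0) (ε : ℚ≥0) : RAM.Store where
  var := fun v => match v with
    | 0 => n
    | 1 => ℓ
    | 2 => ε.num
    | 3 => ε.den
    | _ => 0
  arr := fun a => match a with
    | 0 => flatten fun i x => (P i x).num
    | 1 => flatten fun i x => (P i x).den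
    | 2 => flatten fun i x => (Q i x).num
    | 3 => flatten fun i x => (Q i x).den
    | _ => fun _ => 0

/-- The length of the input: the total binary length of all its numbers. -/
def inputLength {n ℓ : ℕ} (P Q : Fin n → Fin ℓ → ℚ≥0) (ε : ℚ≥0) : ℕ :=
  Nat.size n + Nat.size ℓ + Nat.size ε.num + Nat.size ε.den +
    ∑ i, ∑ x, (Nat.size (P i x).num + Nat.size (P i x).den +
      Nat.size (Q i x).num + Nat.size (Q i x).den)

/-- The rational number that a final memory presents as its output: variable `0` is the numerator
and variable `1` the denominator. -/
def outputValue (s : RAM.Store) : ℚ≥0 := (s.var 0 : ℚ≥0) / (s.var 1 : ℚ≥0)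

/-- The quantity `n³ ℓ log₂((1 + ε) / (ε τ)) / ε`. -/
noncomputable def timeScale (n ℓ : ℕ) (ε τ : ℝ) : ℝ :=
  (n : ℝ) ^ 3 * (ℓ : ℝ) * Real.logb 2 ((1 + ε) / (ε * τ)) / ε

/-! Off the zeros of `P`, the similarity is the sum of `P y * min 1 (Q y / P y)`, and the logarithm
of the likelihood ratio is additive over the coordinates. Fix `ρ = 1 + 1/m` and an integer `T` at
least the inverse of every nonzero probability. If `p` and `q` are nonzero marginal probabilities of
the same entry, then `q * T / p ≥ 1`, so this ratio can be rounded down to a power `ρ ^ g` with a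
natural number `g`, the level of the entry. Entries with `q = 0` get mass zero. A point `y` then
contributes its mass times `min 1 (ρ ^ s / T ^ n)`, where `s` is the sum of its levels. Rounding
loses a factor at most `ρ` per coordinate (`le_mul_level`, `mul_le_mul_level`), hence at most `ρ ^
n` in the sum (`min_prod_le`, `output_bounds`). With `m = 2 * n * w` and `w = ⌊1/ε⌋ + 1` this is at
most `1 + ε` (`add_one_div_pow_le`).

The contribution depends on `y` only through its mass and `s`, so it suffices to know the total mass
at each `s`. These masses are the coefficients of a product of `n` row polynomials (`levelPoly`,
`sum_coeff_levelPoly`), multiplied out row by row in place (`coeff_levelPoly_succ`,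
`rowUpdate_runs`). Levels are at most `G = O(m * log T)` (`level_le_of_probability`), so there are
`K = n * G + 1` sums and `O(n * ℓ * K)` operations, which gives the time bound.

Everything is done in natural numbers, over the denominator `(D * T) ^ n * m ^ K` with `D` a common
denominator of the `P i x`. All values stay below `2 ^ Z` with `Z` polynomial in the input length
and `1/ε` (`similarity_runs_of_length`), so the bit cost is the operation count times `O(Z)`.
Execution is treated by a Hoare-style predicate `Runs` that carries the operation count, the value
bound and the postcondition together. -/

namespace RAM

/-! ### A program logic with costs -/

/-- The number of nodes of an expression, a constant `c` counting as `c + 1` nodes. -/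
def Expr.weight : Expr → ℕ
  | const c => c + 1
  | var _ => 1
  | read _ e => e.weight + 1
  | add e₁ e₂ => e₁.weight + e₂.weight + 1
  | sub e₁ e₂ => e₁.weight + e₂.weight + 1
  | mul e₁ e₂ => e₁.weight + e₂.weight + 1
  | div e₁ e₂ => e₁.weight + e₂.weight + 1

/-- All memory cells hold numbers that are at most `V`. -/
structure Bounded (V : ℕ) (s : Store) : Prop where
  var (v : ℕ) : s.var v ≤ V
  arr (a j : ℕ) : s.arr a j ≤ V

theorem size_add_le (a b : ℕ) : (a + b).size ≤ a.size + b.size + 1 := by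
  rw [Nat.size_le]
  have ha := Nat.lt_size_self a
  have hb := Nat.lt_size_self b
  have h1 : 2 ^ a.size ≤ 2 ^ (a.size + b.size) := Nat.pow_le_pow_right (by norm_num) (by omega)
  have h2 : 2 ^ b.size ≤ 2 ^ (a.size + b.size) := Nat.pow_le_pow_right (by norm_num) (by omega)
  rw [pow_succ]
  omega

theorem size_mul_le (a b : ℕ) : (a * b).size ≤ a.size + b.size := by
  rw [Nat.size_le, pow_add]
  exact Nat.mul_lt_mul'' (Nat.lt_size_self a) (Nat.lt_size_self b)

/-- Lengths at most add up under each operation, plus one for a carry. Counting constants in unary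
makes the weight absorb their length as well. -/
theorem Bounded.size_eval_le {V : ℕ} {s : Store} (hs : Bounded V s) (e : Expr) :
    (e.eval s).size ≤ e.weight * (V.size + 1) := by
  induction e with
  | const c =>
    have : c.size ≤ c := Nat.size_le.2 Nat.lt_two_pow_self
    simp only [Expr.eval, Expr.weight]
    nlinarith
  | var v =>
    have := Nat.size_le_size (hs.var v)
    simp only [Expr.eval, Expr.weight]
    omega
  | read a e =>
    have := Nat.size_le_size (hs.arr a (e.eval s))
    simp only [Expr.eval, Expr.weight]
    nlinarith
  | add e₁ e₂ h₁ h₂ =>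
    have := size_add_le (e₁.eval s) (e₂.eval s)
    simp only [Expr.eval, Expr.weight]
    nlinarith
  | sub e₁ e₂ h₁ h₂ =>
    have := Nat.size_le_size (Nat.sub_le (e₁.eval s) (e₂.eval s))
    simp only [Expr.eval, Expr.weight]
    nlinarith
  | mul e₁ e₂ h₁ h₂ =>
    have := size_mul_le (e₁.eval s) (e₂.eval s)
    simp only [Expr.eval, Expr.weight]
    nlinarith
  | div e₁ e₂ h₁ h₂ =>
    have := Nat.size_le_size (Nat.div_le_self (e₁.eval s) (e₂.eval s))
    simp only [Expr.eval, Expr.weight]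
    nlinarith

/-- A single `W` for the whole tree bounds the cost of each node uniformly, so bit cost becomes
operation count times a constant and needs no separate bookkeeping. -/
theorem Bounded.bits_le_of_weight_le {V : ℕ} {s : Store} (hs : Bounded V s) (e : Expr) {W : ℕ}
    (hW : e.weight ≤ W) : e.bits s ≤ e.ops * (W * (V.size + 1) + 1) := by
  have key : ∀ e : Expr, e.weight ≤ W → (e.eval s).size ≤ W * (V.size + 1) := fun e h =>
    (hs.size_eval_le e).trans (Nat.mul_le_mul_right _ h)
  induction e with
  | const c =>
    have := key _ hW
    simp only [Expr.eval] at this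
    simp only [Expr.bits, Expr.ops]
    omega
  | var v =>
    have := key _ hW
    simp only [Expr.eval] at this
    simp only [Expr.bits, Expr.ops]
    omega
  | read a e h =>
    have := key _ hW
    simp only [Expr.weight] at hW
    have := h (by omega)
    simp only [Expr.bits, Expr.ops]
    linarith
  | add e₁ e₂ h₁ h₂ | sub e₁ e₂ h₁ h₂ | mul e₁ e₂ h₁ h₂ | div e₁ e₂ h₁ h₂ =>
    have := key _ hW
    simp only [Expr.weight] at hW
    have := h₁ (by omega)
    have := h₂ (by omega)
    simp only [Expr.bits, Expr.ops]
    linarith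

/-- A bound for the logarithmic cost of one operation on numbers that are at most `V`. -/
def opCost (V : ℕ) : ℕ := 40 * (V.size + 1) + 1

theorem Bounded.bits_le {V : ℕ} {s : Store} (hs : Bounded V s) (e : Expr)
    (he : e.weight ≤ 40) : e.bits s ≤ e.ops * opCost V :=
  hs.bits_le_of_weight_le e he

/-- The variables that a program may change. -/
def Cmd.varsWritten : Cmd → List ℕ
  | skip => []
  | assign v _ => [v]
  | write _ _ _ => []
  | seq c₁ c₂ => c₁.varsWritten ++ c₂.varsWritten
  | ite _ c₁ c₂ => c₁.varsWritten ++ c₂.varsWritten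
  | loop _ c => c.varsWritten

/-- The arrays that a program may change. -/
def Cmd.arrsWritten : Cmd → List ℕ
  | skip => []
  | assign _ _ => []
  | write a _ _ => [a]
  | seq c₁ c₂ => c₁.arrsWritten ++ c₂.arrsWritten
  | ite _ c₁ c₂ => c₁.arrsWritten ++ c₂.arrsWritten
  | loop _ c => c.arrsWritten

/-- The memories `s` and `s'` differ only in what the program `c` may change. -/
structure Frame (c : Cmd) (s s' : Store) : Prop where
  var (v : ℕ) (hv : v ∉ c.varsWritten := by decide) : s'.var v = s.var v
  arr (a : ℕ) (ha : a ∉ c.arrsWritten := by decide) : s'.arr a = s.arr a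

theorem Frame.refl (c : Cmd) (s : Store) : Frame c s s := ⟨fun _ _ => rfl, fun _ _ => rfl⟩

theorem Frame.trans {c : Cmd} {s₁ s₂ s₃ : Store} (h : Frame c s₁ s₂) (h' : Frame c s₂ s₃) :
    Frame c s₁ s₃ :=
  ⟨fun v hv => (h'.var v hv).trans (h.var v hv), fun a ha => (h'.arr a ha).trans (h.arr a ha)⟩

/-- With this, a loop invariant need only mention what the body changes; for concrete programs the
side conditions are settled by `decide`. -/
theorem Exec.frame {c : Cmd} {s s' : Store} {t b : ℕ} (h : Exec c s s' t b) : Frame c s s' := by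
  induction h with
  | skip => exact Frame.refl _ _
  | assign s v e =>
    refine ⟨fun u hu => ?_, fun a _ => rfl⟩
    simp only [Cmd.varsWritten, List.mem_singleton] at hu
    simp [hu]
  | write s a i e =>
    refine ⟨fun u _ => rfl, fun a ha => ?_⟩
    simp only [Cmd.arrsWritten, List.mem_singleton] at ha
    simp [ha]
  | seq _ _ h₁ h₂ =>
    refine ⟨fun v hv => ?_, fun a ha => ?_⟩
    · simp only [Cmd.varsWritten, List.mem_append, not_or] at hv
      rw [h₂.var v hv.2, h₁.var v hv.1]
    · simp only [Cmd.arrsWritten, List.mem_append, not_or] at ha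
      rw [h₂.arr a ha.2, h₁.arr a ha.1]
  | ite_true _ _ h =>
    refine ⟨fun v hv => ?_, fun a ha => ?_⟩
    · simp only [Cmd.varsWritten, List.mem_append, not_or] at hv
      exact h.var v hv.1
    · simp only [Cmd.arrsWritten, List.mem_append, not_or] at ha
      exact h.arr a ha.1
  | ite_false _ _ h =>
    refine ⟨fun v hv => ?_, fun a ha => ?_⟩
    · simp only [Cmd.varsWritten, List.mem_append, not_or] at hv
      exact h.var v hv.2
    · simp only [Cmd.arrsWritten, List.mem_append, not_or] at ha
      exact h.arr a ha.2
  | loop_false => exact Frame.refl _ _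
  | loop_true _ _ _ h h' =>
    refine ⟨fun v hv => ?_, fun a ha => ?_⟩
    · rw [h'.var v hv, h.var v hv]
    · rw [h'.arr a ha, h.arr a ha]

/-- Started in `s`, the program `c` halts after at most `T` operations, each of them costing at
most `opCost V`, in a memory that is bounded by `V` and satisfies `post`. -/
def Runs (V : ℕ) (c : Cmd) (s : Store) (T : ℕ) (post : Store → Prop) : Prop :=
  ∃ s' t b, Exec c s s' t b ∧ t ≤ T ∧ b ≤ t * opCost V ∧ Bounded V s' ∧ post s'

/-- The memory after an assignment. -/
def Store.setVar (s : Store) (v x : ℕ) : Store := { s with var := Function.update s.var v x }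

/-- The memory after writing to an array cell. -/
def Store.setArr (s : Store) (a j x : ℕ) : Store :=
  { s with arr := Function.update s.arr a (Function.update (s.arr a) j x) }

@[simp] theorem Store.setVar_var (s : Store) (v x u : ℕ) :
    (s.setVar v x).var u = if u = v then x else s.var u := by
  simp [Store.setVar, Function.update_apply]

@[simp] theorem Store.setVar_arr (s : Store) (v x : ℕ) : (s.setVar v x).arr = s.arr := rfl

@[simp] theorem Store.setArr_var (s : Store) (a j x : ℕ) : (s.setArr a j x).var = s.var := rfl

@[simp] theorem Store.setArr_arr (s : Store) (a j x a' j' : ℕ) :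
    (s.setArr a j x).arr a' j' = if a' = a ∧ j' = j then x else s.arr a' j' := by
  by_cases h : a' = a
  · subst h; simp [Store.setArr, Function.update_apply]
  · simp [Store.setArr, h]

theorem Bounded.setVar {V : ℕ} {s : Store} (hs : Bounded V s) {v x : ℕ} (hx : x ≤ V) :
    Bounded V (s.setVar v x) := by
  refine ⟨fun u => ?_, hs.arr⟩
  rw [Store.setVar_var]
  split_ifs
  exacts [hx, hs.var u]

theorem Bounded.setArr {V : ℕ} {s : Store} (hs : Bounded V s) {a j x : ℕ} (hx : x ≤ V) :
    Bounded V (s.setArr a j x) := by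
  refine ⟨hs.var, fun a' j' => ?_⟩
  rw [Store.setArr_arr]
  split_ifs
  exacts [hx, hs.arr a' j']

theorem Runs.mono {V : ℕ} {c : Cmd} {s : Store} {T T' : ℕ} {p q : Store → Prop}
    (h : Runs V c s T p) (hT : T ≤ T')
    (hpq : ∀ s', Bounded V s' → Frame c s s' → p s' → q s') : Runs V c s T' q := by
  obtain ⟨s', t, b, h, ht, hb, hs, hp⟩ := h
  exact ⟨s', t, b, h, ht.trans hT, hb, hs, hpq s' hs h.frame hp⟩

theorem Runs.assign {V : ℕ} {s : Store} {v : ℕ} {e : Expr} {p : Store → Prop}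
    (hs : Bounded V s) (he : e.weight ≤ 40) (hV : e.eval s ≤ V) (hp : p (s.setVar v (e.eval s))) :
    Runs V (.assign v e) s (e.ops + 1) p := by
  refine ⟨_, _, _, Exec.assign s v e, le_rfl, ?_, hs.setVar hV, hp⟩
  have := hs.bits_le e he
  rw [add_mul, one_mul]
  have : 1 ≤ opCost V := by simp [opCost]
  omega

theorem Runs.write {V : ℕ} {s : Store} {a : ℕ} {i e : Expr} {p : Store → Prop}
    (hs : Bounded V s) (hi : i.weight ≤ 40) (he : e.weight ≤ 40) (hV : e.eval s ≤ V)
    (hp : p (s.setArr a (i.eval s) (e.eval s))) :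
    Runs V (.write a i e) s (i.ops + e.ops + 1) p := by
  refine ⟨_, _, _, Exec.write s a i e, le_rfl, ?_, hs.setArr hV, hp⟩
  have := hs.bits_le e he
  have := hs.bits_le i hi
  rw [add_mul, add_mul, one_mul]
  have : 1 ≤ opCost V := by simp [opCost]
  omega

theorem Runs.seq {V : ℕ} {s : Store} {c₁ c₂ : Cmd} {T₁ T₂ : ℕ} {p q : Store → Prop}
    (h₁ : Runs V c₁ s T₁ p)
    (h₂ : ∀ s', Bounded V s' → Frame c₁ s s' → p s' → Runs V c₂ s' T₂ q) :
    Runs V (.seq c₁ c₂) s (T₁ + T₂) q := by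
  obtain ⟨s', t, b, h, ht, hb, hs, hp⟩ := h₁
  obtain ⟨s'', t', b', h', ht', hb', hs', hq⟩ := h₂ s' hs h.frame hp
  exact ⟨s'', _, _, h.seq h', by omega, by rw [add_mul]; omega, hs', hq⟩

/-- The updated store is kept explicit, so that straight-line code is verified by letting `simp`
compute the updates. -/
theorem Runs.assign_seq {V : ℕ} {s : Store} {v : ℕ} {e : Expr} {c : Cmd} {T : ℕ}
    {q : Store → Prop} (hs : Bounded V s) (he : e.weight ≤ 40) (hV : e.eval s ≤ V)
    (h : Bounded V (s.setVar v (e.eval s)) → Runs V c (s.setVar v (e.eval s)) T q) :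
    Runs V (.seq (.assign v e) c) s (e.ops + 1 + T) q :=
  (Runs.assign (p := fun s' => s' = s.setVar v (e.eval s)) hs he hV rfl).seq
    fun _ hs' _ hp => hp ▸ h (hp ▸ hs')

theorem Runs.write_seq {V : ℕ} {s : Store} {a : ℕ} {i e : Expr} {c : Cmd} {T : ℕ}
    {q : Store → Prop} (hs : Bounded V s) (hi : i.weight ≤ 40) (he : e.weight ≤ 40)
    (hV : e.eval s ≤ V)
    (h : Bounded V (s.setArr a (i.eval s) (e.eval s)) →
      Runs V c (s.setArr a (i.eval s) (e.eval s)) T q) :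
    Runs V (.seq (.write a i e) c) s (i.ops + e.ops + 1 + T) q :=
  (Runs.write (p := fun s' => s' = s.setArr a (i.eval s) (e.eval s)) hs hi he hV rfl).seq
    fun _ hs' _ hp => hp ▸ h (hp ▸ hs')

/-- The rule for loops that are repeated `N` times, with an invariant `I`. -/
theorem Runs.loop {V : ℕ} {s : Store} {e : Expr} {c : Cmd} {T : ℕ} (N : ℕ)
    (I : ℕ → Store → Prop) (hs : Bounded V s) (he : e.weight ≤ 40) (h0 : I 0 s)
    (step : ∀ i s', i < N → Bounded V s' → Frame c s s' → I i s' →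
      e.eval s' ≠ 0 ∧ Runs V c s' T (I (i + 1)))
    (halt : ∀ s', Bounded V s' → Frame c s s' → I N s' → e.eval s' = 0) :
    Runs V (.loop e c) s (N * (e.ops + 1 + T) + (e.ops + 1)) (I N) := by
  -- Induction on the number `d` of remaining rounds; the frame always refers back to the store
  -- before the loop.
  suffices H : ∀ d i s', i + d = N → Bounded V s' → Frame c s s' → I i s' →
      Runs V (.loop e c) s' (d * (e.ops + 1 + T) + (e.ops + 1)) (I N) from
    H N 0 s (by omega) hs (Frame.refl c s) h0
  have hV : 1 ≤ opCost V := by simp [opCost]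
  intro d
  induction d with
  | zero =>
    intro i s' hi hs' hf hI
    obtain rfl : i = N := by omega
    have := hs'.bits_le e he
    refine ⟨_, _, _, Exec.loop_false (halt s' hs' hf hI), by omega, ?_, hs', hI⟩
    rw [add_mul, one_mul]
    omega
  | succ d ih =>
    intro i s' hi hs' hf hI
    obtain ⟨hne, s₂, t, b, hx, ht, hb, hs₂, hI₂⟩ := step i s' (by omega) hs' hf hI
    obtain ⟨s₃, t', b', hx', ht', hb', hs₃, hI₃⟩ :=
      ih (i + 1) s₂ (by omega) hs₂ (hf.trans hx.frame) hI₂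
    have := hs'.bits_le e he
    refine ⟨_, _, _, Exec.loop_true hne hx hx', ?_, ?_, hs₃, hI₃⟩
    · rw [add_mul, one_mul]
      omega
    · rw [add_mul, add_mul, add_mul, one_mul]
      omega

end RAM

/-! ### Levels: integer logarithms to the base `1 + 1/m`, and their generating polynomial. -/

open Polynomial in
/-- The generating polynomial of the first `i` rows of a table with rows of length `ℓ`, where the
entry `k` has the mass `A k` and the level `g k`. -/
noncomputable def levelPoly (A g : ℕ → ℕ) (ℓ i : ℕ) : Polynomial ℕ :=
  ∏ r ∈ Finset.range i, ∑ x ∈ Finset.range ℓ, C (A (ℓ * r + x)) * X ^ g (ℓ * r + x)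

/-- The least `g` with `b * m ^ (g + 1) < a * (m + 1) ^ (g + 1)`, and `0` if `a = 0`: the logarithm
of `b / a` to the base `1 + 1 / m`, rounded down. -/
noncomputable def level (m a b : ℕ) : ℕ :=
  sInf {g | a = 0 ∨ b * m ^ (g + 1) < a * (m + 1) ^ (g + 1)}

/-- Bernoulli's inequality gives `(1 + 1/m) ^ m ≥ 2`: each doubling costs at most `m` levels. -/
theorem two_pow_mul_pow_le {m : ℕ} (hm : 0 < m) (s : ℕ) :
    2 ^ s * m ^ (m * s) ≤ (m + 1) ^ (m * s) := by
  have h := one_add_mul_le_pow (a := (1 : ℚ) / m) (by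
    have : (0 : ℚ) ≤ 1 / m := by positivity
    linarith) m
  have hm' : (0 : ℚ) < m := by exact_mod_cast hm
  have h2 : (1 + (m : ℚ) * (1 / m)) = 2 := by field_simp; norm_num
  have h3 : (1 + (1 : ℚ) / m) ^ m = (m + 1) ^ m / m ^ m := by
    rw [← div_pow]; congr 1; field_simp
  rw [h2, h3, le_div_iff₀ (by positivity)] at h
  rw [pow_mul, pow_mul, ← mul_pow]
  exact Nat.pow_le_pow_left (by exact_mod_cast h) s

theorem mem_level_set {m a b s : ℕ} (hm : 0 < m) (h : a = 0 ∨ b < a * 2 ^ s) :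
    m * s ∈ {g | a = 0 ∨ b * m ^ (g + 1) < a * (m + 1) ^ (g + 1)} := by
  refine h.imp_right fun h => ?_
  have h2 : 2 ^ s * m ^ (m * s + 1) ≤ (m + 1) ^ (m * s + 1) := by
    rw [pow_succ, pow_succ, ← mul_assoc]
    exact Nat.mul_le_mul (two_pow_mul_pow_le hm s) (Nat.le_succ m)
  calc b * m ^ (m * s + 1) < a * 2 ^ s * m ^ (m * s + 1) :=
        Nat.mul_lt_mul_of_pos_right h (by positivity)
    _ = a * (2 ^ s * m ^ (m * s + 1)) := mul_assoc _ _ _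
    _ ≤ _ := Nat.mul_le_mul_left _ h2

theorem level_le {m a b s : ℕ} (hm : 0 < m) (h : a = 0 ∨ b < a * 2 ^ s) : level m a b ≤ m * s :=
  Nat.sInf_le (mem_level_set hm h)

/-- The set defining the level is nonempty: for `a ≠ 0`, the number `2 ^ b.size` already exceeds `b
/ a`. -/
theorem level_spec {m a b : ℕ} (hm : 0 < m) :
    a = 0 ∨ b * m ^ (level m a b + 1) < a * (m + 1) ^ (level m a b + 1) := by
  refine Nat.sInf_mem ⟨m * b.size, mem_level_set hm ?_⟩
  rcases Nat.eq_zero_or_pos a with ha | ha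
  · exact Or.inl ha
  · exact Or.inr ((Nat.lt_size_self b).trans_le (Nat.le_mul_of_pos_left _ ha))

theorem not_of_lt_level {m a b i : ℕ} (hi : i < level m a b) :
    a ≠ 0 ∧ a * (m + 1) ^ (i + 1) ≤ b * m ^ (i + 1) := by
  simpa using Nat.notMem_of_lt_sInf hi

namespace RAM

/-- The maximum of two expressions. -/
def Expr.max (e₁ e₂ : Expr) : Expr := .add e₁ (.sub e₂ e₁)

/-- The minimum of two expressions. -/
def Expr.min (e₁ e₂ : Expr) : Expr := .sub e₁ (.sub e₁ e₂)

@[simp] theorem Expr.eval_max (s : Store) (e₁ e₂ : Expr) :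
    (Expr.max e₁ e₂).eval s = Max.max (e₁.eval s) (e₂.eval s) := by
  simp only [Expr.max, Expr.eval]
  omega

@[simp] theorem Expr.eval_min (s : Store) (e₁ e₂ : Expr) :
    (Expr.min e₁ e₂).eval s = Min.min (e₁.eval s) (e₂.eval s) := by
  simp only [Expr.min, Expr.eval]
  omega

/-! ### The program

The variables `0, …, 3` hold `n`, `ℓ` and the numerator and denominator of `ε`, and the further
variables
* `4`: the number `m`, the levels being powers of `1 + 1 / m`;
* `5`: the number `n * ℓ` of table entries;
* `6`: a counter;
* `7`: a bound for the inverses of the nonzero probabilities;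
* `8`: a common denominator of the probabilities `P i x`;
* `9`, `10`, `11`: a level and the two numbers compared to find it;
* `12`: the maximal level;
* `13`: the number of cells of array `6` in use;
* `14`, `15`, `17`: the row, the cell and the column under consideration;
* `16`: the new content of the cell;
* `18`, `19`, `20`: denominators and scaling factors of the output.

Array `4` holds the masses of the table entries, array `5` their levels, and array `6` the total
mass at each level. -/

/-- Advance a counter. -/
def incr (v : ℕ) : Cmd := .assign v (.add (.var v) (.const 1))

/-- Account for one table entry in the variables `7` and `8`. -/
def scanBody : Cmd :=
  .seq (.assign 7 (.max (.add (.div (.read 1 (.var 6)) (.read 0 (.var 6))) (.const 1)) (.var 7))) <|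
  .seq (.assign 7 (.max (.add (.div (.read 3 (.var 6)) (.read 2 (.var 6))) (.const 1)) (.var 7))) <|
  .seq (.assign 8 (.mul (.var 8) (.read 1 (.var 6)))) <|
  incr 6

/-- Compute the variables `7` and `8`. -/
def scan : Cmd := .loop (.sub (.var 5) (.var 6)) scanBody

/-- Search for the level. -/
def findLevel : Cmd :=
  .loop (.mul (.var 10) (.sub (.add (.mul (.var 11) (.var 4)) (.const 1))
    (.mul (.var 10) (.add (.var 4) (.const 1))))) <|
  .seq (incr 9) <|
  .seq (.assign 10 (.mul (.var 10) (.add (.var 4) (.const 1)))) <|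
  .assign 11 (.mul (.var 11) (.var 4))

/-- Compute the mass and the level of one table entry. -/
def tableBody : Cmd :=
  .seq (.assign 9 (.const 0)) <|
  .seq (.assign 10 (.mul (.read 0 (.var 6)) (.read 3 (.var 6)))) <|
  .seq (.assign 11 (.mul (.mul (.read 2 (.var 6)) (.read 1 (.var 6))) (.var 7))) <|
  .seq findLevel <|
  .seq (.write 4 (.var 6) (.mul (.sub (.const 1) (.sub (.const 1) (.read 2 (.var 6))))
    (.mul (.read 0 (.var 6)) (.div (.var 8) (.read 1 (.var 6)))))) <|
  .seq (.write 5 (.var 6) (.var 9)) <|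
  .seq (.assign 12 (.max (.var 9) (.var 12))) <|
  incr 6

/-- Compute the masses and the levels of the table entries. -/
def table : Cmd := .loop (.sub (.var 5) (.var 6)) tableBody

/-- Add up the mass that arrives at the level `var 15` from the row `var 14`. -/
def gather : Cmd :=
  .loop (.sub (.var 1) (.var 17)) <|
  .seq (.assign 16 (.add (.var 16)
    (.mul (.mul (.read 4 (.add (.mul (.var 1) (.var 14)) (.var 17)))
      (.sub (.const 1) (.sub (.read 5 (.add (.mul (.var 1) (.var 14)) (.var 17))) (.var 15))))
      (.read 6 (.sub (.var 15) (.read 5 (.add (.mul (.var 1) (.var 14)) (.var 17)))))))) <|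
  incr 17

/-- Update the masses of all levels with the row `var 14`, from the highest level downwards. -/
def rowUpdate : Cmd :=
  .loop (.var 15) <|
  .seq (.assign 15 (.sub (.var 15) (.const 1))) <|
  .seq (.assign 16 (.const 0)) <|
  .seq (.assign 17 (.const 0)) <|
  .seq gather <|
  .write 6 (.var 15) (.var 16)

/-- Compute the masses of all levels. -/
def allRows : Cmd :=
  .loop (.sub (.var 0) (.var 14)) <|
  .seq (.assign 15 (.var 13)) <|
  .seq rowUpdate <|
  .seq (.assign 18 (.mul (.var 18) (.mul (.var 8) (.var 7)))) <|
  .seq (.assign 20 (.mul (.var 20) (.var 7))) <|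
  incr 14

/-- Compute a power of `var 4`. -/
def power : Cmd :=
  .loop (.sub (.var 13) (.var 6)) <|
  .seq (.assign 19 (.mul (.var 19) (.var 4))) <|
  incr 6

/-- Add up the contributions of all levels to the output. -/
def total : Cmd :=
  .loop (.sub (.var 13) (.var 6)) <|
  .seq (.assign 0 (.add (.var 0) (.mul (.read 6 (.var 6)) (.min (.var 20) (.var 19))))) <|
  .seq (.assign 19 (.div (.mul (.var 19) (.add (.var 4) (.const 1))) (.var 4))) <|
  incr 6

/-- Compute the parameters, the masses and the levels. -/
def prepare : Cmd :=
  .seq (.assign 4 (.mul (.mul (.const 2) (.var 0)) (.add (.div (.var 3) (.var 2)) (.const 1)))) <|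
  .seq (.assign 5 (.mul (.var 0) (.var 1))) <|
  .seq (.assign 8 (.const 1)) <|
  .seq scan <|
  .seq (.assign 6 (.const 0)) <|
  .seq table <|
  .assign 13 (.add (.mul (.var 0) (.var 12)) (.const 1))

/-- Compute the total mass at each level. -/
def distribute : Cmd :=
  .seq (.write 6 (.const 0) (.const 1)) <|
  .seq (.assign 18 (.const 1)) <|
  .seq (.assign 20 (.const 1)) <|
  allRows

/-- Compute the numerator and the denominator of the output. -/
def output : Cmd :=
  .seq (.assign 6 (.const 0)) <|
  .seq (.assign 19 (.const 1)) <|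
  .seq power <|
  .seq (.assign 20 (.mul (.var 20) (.var 19))) <|
  .seq (.assign 18 (.mul (.var 18) (.var 19))) <|
  .seq (.assign 0 (.const 0)) <|
  .seq (.assign 6 (.const 0)) <|
  .seq total <|
  .assign 1 (.var 18)

/-- The approximation scheme for the statistical similarity of product distributions. -/
def similarity : Cmd := .seq prepare <| .seq distribute output

open Finset

/-! ### Correctness and operation counts of the subprograms. -/

theorem scan_runs {V N : ℕ} {s : Store} (hs : Bounded V s) (h5 : s.var 5 = N) (h6 : s.var 6 = 0)
    (h7 : s.var 7 = 0) (h8 : s.var 8 = 1) (hN : N ≤ V)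
    (hT : (range N).sup (fun k => max (s.arr 1 k / s.arr 0 k + 1) (s.arr 3 k / s.arr 2 k + 1)) ≤ V)
    (hD : ∀ k ≤ N, ∏ i ∈ range k, s.arr 1 i ≤ V) :
    Runs V scan s (N * 60 + 4) (fun s' =>
      s'.var 7 = (range N).sup
        (fun k => max (s.arr 1 k / s.arr 0 k + 1) (s.arr 3 k / s.arr 2 k + 1)) ∧
      s'.var 8 = ∏ i ∈ range N, s.arr 1 i) := by
  set f : ℕ → ℕ := fun k => max (s.arr 1 k / s.arr 0 k + 1) (s.arr 3 k / s.arr 2 k + 1)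
  have hf : ∀ k, f k = max (s.arr 1 k / s.arr 0 k + 1) (s.arr 3 k / s.arr 2 k + 1) := fun _ => rfl
  clear_value f
  refine (Runs.loop (T := 56) N (fun k s' => s'.var 6 = k ∧ s'.var 7 = (range k).sup f ∧
    s'.var 8 = ∏ i ∈ range k, s.arr 1 i) hs (by decide) ⟨h6, by simpa using h7, by simpa using h8⟩
    ?_ ?_).mono le_rfl fun s' _ _ h => h.2
  · rintro k s' hk hs' hfr ⟨h6', h7', h8'⟩
    have h5' := hfr.var 5
    have a0 := hfr.arr 0
    have a1 := hfr.arr 1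
    have a2 := hfr.arr 2
    have a3 := hfr.arr 3
    have hsup : (range (k + 1)).sup f ≤ V :=
      (Finset.sup_mono (range_subset_range.2 hk)).trans hT
    have hprod := hD (k + 1) hk
    rw [range_add_one, sup_insert, hf] at hsup
    rw [prod_range_succ] at hprod
    refine ⟨by simp only [Expr.eval]; omega, ?_⟩
    refine (Runs.assign_seq hs' (by decide) ?_ fun hs₁ => Runs.assign_seq hs₁ (by decide) ?_
      fun hs₂ => Runs.assign_seq hs₂ (by decide) ?_ fun hs₃ => Runs.assign hs₃ (by decide) ?_
      ?_).mono (by decide) fun _ _ _ h => h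
    · simp only [Expr.eval_max, Expr.eval, h6', h7', a0, a1]
      omega
    · simp [Expr.eval, h6', h7', a0, a1, a2, a3, -Finset.sup_le_iff]
      omega
    · simpa [Expr.eval, h6', h8', a1] using hprod
    · simp [Expr.eval, h6']; omega
    · refine ⟨by simp [Expr.eval, h6'], ?_, by simp [Expr.eval, h6', h8', a1, prod_range_succ]⟩
      -- The program folds in the two quotients one after the other, so the nested maxima have to be
      -- regrouped.
      rw [range_add_one, sup_insert, hf, max_comm (s.arr 1 k / s.arr 0 k + 1)]
      simp [Expr.eval, h6', h7', a0, a1, a2, a3]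
      rw [← max_assoc, Nat.add_max_add_right]
  · rintro s' hs' hfr ⟨h6', -, -⟩
    have h5' := hfr.var 5
    simp only [Expr.eval]
    omega

/-- With `x` and `y` in variables `10` and `11`, the test is `x * (y * m + 1 - x * (m + 1))`. It is
nonzero exactly if `x ≠ 0` and `x * (m + 1) ≤ y * m`, which is the failure of the defining condition
of `level` at the current counter. -/
theorem findLevel_runs {V m a b : ℕ} {s : Store} (hs : Bounded V s) (hm : 0 < m)
    (h4 : s.var 4 = m) (h9 : s.var 9 = 0) (h10 : s.var 10 = a) (h11 : s.var 11 = b)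
    (hl : level m a b ≤ V) (hV : ∀ i ≤ level m a b, a * (m + 1) ^ i ≤ V ∧ b * m ^ i ≤ V) :
    Runs V findLevel s (level m a b * 40 + 14) (fun s' => s'.var 9 = level m a b) := by
  refine (Runs.loop (T := 16) (level m a b) (fun i s' => s'.var 9 = i ∧
    s'.var 10 = a * (m + 1) ^ i ∧ s'.var 11 = b * m ^ i) hs (by decide)
    ⟨h9, by simpa using h10, by simpa using h11⟩
    ?_ ?_).mono (by simp [Expr.ops]; omega) fun s' _ _ h => h.1
  · rintro i s' hi hs' hfr ⟨h9', h10', h11'⟩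
    have h4' := hfr.var 4
    obtain ⟨ha, hab⟩ := not_of_lt_level hi
    obtain ⟨hV1, hV2⟩ := hV (i + 1) hi
    rw [pow_succ, ← mul_assoc] at hV1 hV2 hab
    rw [pow_succ, ← mul_assoc] at hab
    refine ⟨?_, ?_⟩
    · simp only [Expr.eval, h10', h11', h4', h4]
      refine Nat.mul_ne_zero (Nat.mul_ne_zero ha (by positivity)) ?_
      omega
    refine (Runs.assign_seq hs' (by decide) ?_ fun hs₁ => Runs.assign_seq hs₁ (by decide) ?_
      fun hs₂ => Runs.assign hs₂ (by decide) ?_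
      ?_).mono (by decide) fun _ _ _ h => h
    · simp only [Expr.eval]; omega
    · simp [Expr.eval, *]
    · simp [Expr.eval, *]
    · simp [Expr.eval, *, pow_succ, mul_assoc]
  · rintro s' hs' hfr ⟨-, h10', h11'⟩
    have h4' := hfr.var 4
    simp only [Expr.eval, h10', h11', h4', h4]
    rcases level_spec (a := a) (b := b) hm with h | h
    · simp [h]
    · rw [pow_succ, ← mul_assoc, pow_succ, ← mul_assoc] at h
      rw [Nat.sub_eq_zero_of_le (by omega), mul_zero]

/-- The mass of a table entry: the numerator of `P i x` over the common denominator `D`, or `0` if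
`Q i x = 0`. -/
def entryMass (D p d q : ℕ) : ℕ := (1 - (1 - q)) * (p * (D / d))

theorem table_runs {V N m D T : ℕ} {s : Store} (hs : Bounded V s) (hm : 0 < m) {A g : ℕ → ℕ}
    (hA : ∀ k, A k = entryMass D (s.arr 0 k) (s.arr 1 k) (s.arr 2 k))
    (hg : ∀ k, g k = level m (s.arr 0 k * s.arr 3 k) (s.arr 2 k * s.arr 1 k * T))
    (h4 : s.var 4 = m) (h5 : s.var 5 = N) (h6 : s.var 6 = 0) (h7 : s.var 7 = T) (h8 : s.var 8 = D)
    (h12 : s.var 12 = 0) (hN : N ≤ V) (hAV : ∀ k < N, A k ≤ V) (hgV : ∀ k < N, g k ≤ V)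
    (hV : ∀ k < N, ∀ i ≤ g k, s.arr 0 k * s.arr 3 k * (m + 1) ^ i ≤ V ∧
      s.arr 2 k * s.arr 1 k * T * m ^ i ≤ V) :
    Runs V table s (N * (100 + (range N).sup g * 40) + 4) (fun s' =>
      (∀ k < N, s'.arr 4 k = A k ∧ s'.arr 5 k = g k) ∧ s'.var 12 = (range N).sup g) := by
  refine (Runs.loop (T := 90 + (range N).sup g * 40) N (fun k s' => s'.var 6 = k ∧
    (∀ i < k, s'.arr 4 i = A i ∧ s'.arr 5 i = g i) ∧ s'.var 12 = (range k).sup g) hs (by decide)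
    ⟨h6, by simp, by simpa using h12⟩ ?_ ?_).mono
      (Nat.add_le_add (Nat.mul_le_mul_left _ (by simp only [Expr.ops]; omega)) (by decide)) fun s' _ _ h => h.2
  · rintro k s' hk hs' hfr ⟨h6', h45, h12'⟩
    have h4' := hfr.var 4
    have h5' := hfr.var 5
    have h7' := hfr.var 7
    have h8' := hfr.var 8
    have a0 := hfr.arr 0
    have a1 := hfr.arr 1
    have a2 := hfr.arr 2
    have a3 := hfr.arr 3
    rw [h4] at h4'
    rw [h7] at h7'
    rw [h8] at h8'
    have hle : g k ≤ (range N).sup g := Finset.le_sup (mem_range.2 hk)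
    have hsup : (range k).sup g ≤ V := Finset.sup_le fun i hi => hgV i (by
      rw [mem_range] at hi; omega)
    have hAk := hA k
    have hgk := hg k
    have hgVk := hgV k hk
    have hAVk := hAV k hk
    have hVk := hV k hk
    obtain ⟨hV1, hV2⟩ := hVk 0 (Nat.zero_le _)
    refine ⟨by simp only [Expr.eval]; omega, ?_⟩
    refine (Runs.assign_seq hs' (by decide) ?_ fun hs₁ => Runs.assign_seq hs₁ (by decide) ?_
      fun hs₂ => Runs.assign_seq hs₂ (by decide) ?_ fun hs₃ =>
      Runs.seq (T₂ := 45) (findLevel_runs hs₃ hm (a := s.arr 0 k * s.arr 3 k)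
        (b := s.arr 2 k * s.arr 1 k * T) ?_ ?_ ?_ ?_ (hgk ▸ hgVk) (hgk ▸ hVk))
      fun s₁ hs₄ hf₁ h9' => ?_).mono ?_ fun _ _ _ h => h
    · simp [Expr.eval]
    · simpa [Expr.eval, h6', a0, a3] using hV1
    · simpa [Expr.eval, h6', h7', a1, a2] using hV2
    · simp [h4']
    · simp [Expr.eval]
    · simp [Expr.eval, h6', a0, a3]
    · simp [Expr.eval, h6', h7', a1, a2]
    · have b6 : s₁.var 6 = k := (hf₁.var 6).trans (by simp [h6'])
      have b8 : s₁.var 8 = D := (hf₁.var 8).trans (by simp [h8'])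
      have b12 : s₁.var 12 = (range k).sup g := (hf₁.var 12).trans (by simp [h12'])
      have b0 : s₁.arr 0 = s.arr 0 := (hf₁.arr 0).trans (by simp [a0])
      have b1 : s₁.arr 1 = s.arr 1 := (hf₁.arr 1).trans (by simp [a1])
      have b2 : s₁.arr 2 = s.arr 2 := (hf₁.arr 2).trans (by simp [a2])
      have b45 : ∀ i < k, s₁.arr 4 i = A i ∧ s₁.arr 5 i = g i := by
        rw [hf₁.arr 4, hf₁.arr 5]
        simpa using h45
      rw [← hgk] at h9'
      refine (Runs.write_seq hs₄ (by decide) (by decide) ?_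
        fun hs₅ => Runs.write_seq hs₅ (by decide) (by decide) ?_ fun hs₆ =>
        Runs.assign_seq hs₆ (by decide) ?_ fun hs₇ => Runs.assign hs₇ (by decide) ?_
        ?_).mono (by decide) fun _ _ _ h => h
      · simpa [Expr.eval, b6, b8, b0, b1, b2, hAk, entryMass] using hAVk
      · simpa [Expr.eval, h9'] using hgVk
      · simp [Expr.eval, h9', b12, hgVk, -Finset.sup_le_iff, hsup]
      · simp [Expr.eval, b6]; omega
      · refine ⟨by simp [Expr.eval, b6], fun i hi => ?_,
          by simp [Expr.eval, b12, h9', range_add_one]⟩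
        rcases Nat.lt_succ_iff_lt_or_eq.1 hi with hi | rfl
        · simp [Expr.eval, b6, hi.ne, b45 i hi]
        · simp [Expr.eval, b6, b0, b1, b2, b8, h9', hAk, entryMass]
    · simp only [Expr.ops, ← hgk]
      omega
  · rintro s' hs' hfr ⟨h6', -, -⟩
    have h5' := hfr.var 5
    simp only [Expr.eval]
    omega

theorem sum_range_le_of_le {f : ℕ → ℕ} {k N V : ℕ} (hk : k ≤ N) (h : ∑ i ∈ range N, f i ≤ V) :
    ∑ i ∈ range k, f i ≤ V :=
  (sum_le_sum_of_subset (range_subset_range.2 hk)).trans h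

theorem gather_runs {V ℓ i j : ℕ} {s : Store} (hs : Bounded V s) {f : ℕ → ℕ}
    (hf : ∀ x, f x = s.arr 4 (ℓ * i + x) * (1 - (s.arr 5 (ℓ * i + x) - j)) *
      s.arr 6 (j - s.arr 5 (ℓ * i + x)))
    (h1 : s.var 1 = ℓ) (h14 : s.var 14 = i) (h15 : s.var 15 = j) (h16 : s.var 16 = 0)
    (h17 : s.var 17 = 0) (hl : ℓ ≤ V) (hV : ∑ x ∈ range ℓ, f x ≤ V) :
    Runs V gather s (ℓ * 50 + 4) (fun s' => s'.var 16 = ∑ x ∈ range ℓ, f x) := by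
  refine (Runs.loop (T := 46) ℓ (fun x s' => s'.var 17 = x ∧ s'.var 16 = ∑ y ∈ range x, f y) hs
    (by decide) ⟨h17, by simpa using h16⟩ ?_ ?_).mono
      (Nat.add_le_add (Nat.mul_le_mul_left _ (by simp only [Expr.ops]; omega)) (by decide)) fun s' _ _ h => h.2
  · rintro x s' hx hs' hfr ⟨h17', h16'⟩
    have h1' := hfr.var 1
    have h14' := hfr.var 14
    have h15' := hfr.var 15
    have a4 := hfr.arr 4
    have a5 := hfr.arr 5
    have a6 := hfr.arr 6
    have hsum := sum_range_le_of_le (k := x + 1) hx hV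
    rw [sum_range_succ, hf] at hsum
    refine ⟨by simp only [Expr.eval]; omega, ?_⟩
    refine (Runs.assign_seq hs' (by decide) ?_ fun hs₁ => Runs.assign hs₁ (by decide) ?_
      ?_).mono (by decide) fun _ _ _ h => h
    · simpa [Expr.eval, h1', h14', h15', h16', h17', a4, a5, a6, h1, h14, h15] using hsum
    · simp [Expr.eval, h17']; omega
    · simp [Expr.eval, h1', h14', h15', h16', h17', a4, a5, a6, h1, h14, h15, sum_range_succ, hf]
  · rintro s' hs' hfr ⟨h17', -⟩
    have h1' := hfr.var 1
    simp only [Expr.eval]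
    omega

/-- The factor `1 - (g - j)` in truncated subtraction is the indicator of `g ≤ j`; it cancels the
spurious coefficient at `j - g = 0` otherwise. This is the form in which the program evaluates the
recursion. -/
theorem coeff_levelPoly_succ (A g : ℕ → ℕ) (ℓ i j : ℕ) :
    (levelPoly A g ℓ (i + 1)).coeff j = ∑ x ∈ range ℓ, A (ℓ * i + x) *
      (1 - (g (ℓ * i + x) - j)) * (levelPoly A g ℓ i).coeff (j - g (ℓ * i + x)) := by
  rw [levelPoly, prod_range_succ, ← levelPoly, mul_sum, Polynomial.finsetSum_coeff]
  refine sum_congr rfl fun x _ => ?_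
  rw [mul_left_comm, Polynomial.coeff_C_mul, Polynomial.coeff_mul_X_pow', mul_assoc]
  split_ifs with h
  · rw [Nat.sub_eq_zero_of_le h, Nat.sub_zero, one_mul]
  · rw [show 1 - (g (ℓ * i + x) - j) = 0 by omega, zero_mul]

/-- The new coefficient at `j` depends only on old ones at indices at most `j`. Going downwards,
these have not been overwritten yet, so one array suffices. -/
theorem rowUpdate_runs {V ℓ i n K : ℕ} {s : Store} (hs : Bounded V s) {A g : ℕ → ℕ}
    (hA : ∀ k < n * ℓ, s.arr 4 k = A k ∧ s.arr 5 k = g k) (hi : i < n)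
    (h1 : s.var 1 = ℓ) (h14 : s.var 14 = i) (h15 : s.var 15 = K)
    (h6 : ∀ j < K, s.arr 6 j = (levelPoly A g ℓ i).coeff j)
    (hl : ℓ ≤ V) (hK : K ≤ V) (hV : ∀ j < K, (levelPoly A g ℓ (i + 1)).coeff j ≤ V) :
    Runs V rowUpdate s (K * (ℓ * 50 + 20) + 2)
      (fun s' => ∀ j < K, s'.arr 6 j = (levelPoly A g ℓ (i + 1)).coeff j) := by
  refine (Runs.loop (T := ℓ * 50 + 18) K (fun c s' => s'.var 15 = K - c ∧ ∀ j < K, s'.arr 6 j =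
    if j < K - c then (levelPoly A g ℓ i).coeff j else (levelPoly A g ℓ (i + 1)).coeff j) hs
    (by decide) ⟨h15, fun j hj => by simpa [hj] using h6 j hj⟩ ?_ ?_).mono
      (Nat.add_le_add (Nat.mul_le_mul_left _ (by simp only [Expr.ops]; omega)) (by decide)) fun s' _ _ h => by simpa using h.2
  · rintro c s' hc hs' hfr ⟨h15', h6'⟩
    have h1' := hfr.var 1
    have h14' := hfr.var 14
    have a4 := hfr.arr 4
    have a5 := hfr.arr 5
    refine ⟨by simp only [Expr.eval]; omega, ?_⟩
    have hco := coeff_levelPoly_succ A g ℓ i (K - c - 1)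
    have hVc := hV (K - c - 1) (by omega)
    have hrow : ∀ x < ℓ, ℓ * i + x < n * ℓ := fun x hx => by
      calc ℓ * i + x < ℓ * (i + 1) := by rw [mul_add_one]; omega
        _ ≤ ℓ * n := Nat.mul_le_mul_left _ hi
        _ = n * ℓ := mul_comm _ _
    have hsum : ∑ x ∈ range ℓ, s.arr 4 (ℓ * i + x) * (1 - (s.arr 5 (ℓ * i + x) - (K - c - 1))) *
        s'.arr 6 (K - c - 1 - s.arr 5 (ℓ * i + x)) =
          (levelPoly A g ℓ (i + 1)).coeff (K - c - 1) := by
      rw [hco]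
      refine sum_congr rfl fun x hx => ?_
      rw [mem_range] at hx
      rw [(hA _ (hrow x hx)).1, (hA _ (hrow x hx)).2, h6' _ (by omega), if_pos (by omega)]
    refine (Runs.assign_seq hs' (by decide) ?_ fun hs₁ => Runs.assign_seq hs₁ (by decide) ?_
      fun hs₂ => Runs.assign_seq hs₂ (by decide) ?_ fun hs₃ =>
      Runs.seq (T₂ := 3) (gather_runs hs₃ (ℓ := ℓ) (i := i) (j := K - c - 1)
      (f := fun x => s.arr 4 (ℓ * i + x) * (1 - (s.arr 5 (ℓ * i + x) - (K - c - 1))) *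
        s'.arr 6 (K - c - 1 - s.arr 5 (ℓ * i + x))) ?_ ?_ ?_ ?_ ?_ ?_ hl (hsum ▸ hVc))
      fun s₁ hs₄ hf₁ h16' => Runs.write hs₄ (by decide) (by decide) ?_ ?_).mono ?_ fun _ _ _ h => h
    · simp [Expr.eval, h15']; omega
    · simp [Expr.eval]
    · simp [Expr.eval]
    · simp [a4, a5]
    · simp [h1', h1]
    · simp [h14', h14]
    · simp [Expr.eval, h15']
    · simp [Expr.eval]
    · simp [Expr.eval]
    · simp only [Expr.eval, h16', hsum, hVc]
    · have b15 : s₁.var 15 = K - c - 1 := (hf₁.var 15).trans (by simp [Expr.eval, h15'])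
      have b6 : s₁.arr 6 = s'.arr 6 := (hf₁.arr 6).trans (by simp)
      refine ⟨by simp [b15]; omega, fun j hj => ?_⟩
      simp only [Expr.eval, b15, h16', hsum, Store.setArr_arr, true_and, b6, h6' j hj]
      by_cases hjc : j = K - c - 1
      · subst hjc
        rw [if_pos rfl, if_neg (by omega)]
      · rw [if_neg hjc]
        by_cases hj' : j < K - c
        · rw [if_pos hj', if_pos (by omega)]
        · rw [if_neg hj', if_neg (by omega)]
    · simp only [Expr.ops]; omega
  · rintro s' hs' hfr ⟨h15', -⟩
    simp [Expr.eval, h15']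

theorem allRows_runs {V ℓ n K D T : ℕ} {s : Store} (hs : Bounded V s) {A g : ℕ → ℕ}
    (hA : ∀ k < n * ℓ, s.arr 4 k = A k ∧ s.arr 5 k = g k)
    (h0 : s.var 0 = n) (h1 : s.var 1 = ℓ) (h7 : s.var 7 = T) (h8 : s.var 8 = D)
    (h13 : s.var 13 = K) (h14 : s.var 14 = 0) (h18 : s.var 18 = 1) (h20 : s.var 20 = 1)
    (h6 : ∀ j < K, s.arr 6 j = if j = 0 then 1 else 0)
    (hn : n ≤ V) (hl : ℓ ≤ V) (hK : K ≤ V)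
    (hV : ∀ i ≤ n, ∀ j < K, (levelPoly A g ℓ i).coeff j ≤ V)
    (hDT : ∀ i ≤ n, (D * T) ^ i ≤ V ∧ T ^ i ≤ V) :
    Runs V allRows s (n * (K * (ℓ * 50 + 20) + 25) + 4)
      (fun s' => (∀ j < K, s'.arr 6 j = (levelPoly A g ℓ n).coeff j) ∧
        s'.var 18 = (D * T) ^ n ∧ s'.var 20 = T ^ n) := by
  refine (Runs.loop (T := K * (ℓ * 50 + 20) + 20) n (fun i s' => s'.var 14 = i ∧
    (∀ j < K, s'.arr 6 j = (levelPoly A g ℓ i).coeff j) ∧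
        s'.var 18 = (D * T) ^ i ∧ s'.var 20 = T ^ i) hs
    (by decide) ⟨h14, fun j hj => ?_, by simpa using h18, by simpa using h20⟩ ?_ ?_).mono
      (Nat.add_le_add (Nat.mul_le_mul_left _ (by simp only [Expr.ops]; omega)) (by decide)) fun s' _ _ h => h.2
  -- Before any row the array holds the empty product, the polynomial `1`.
  · rw [h6 j hj, levelPoly, prod_range_zero, Polynomial.coeff_one]
  · rintro i s' hi hs' hfr ⟨h14', h6', h18', h20'⟩
    have h0' := hfr.var 0
    have h1' := hfr.var 1
    have h7' := hfr.var 7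
    have h8' := hfr.var 8
    have h13' := hfr.var 13
    have a4 := hfr.arr 4
    have a5 := hfr.arr 5
    obtain ⟨hV1, hV2⟩ := hDT (i + 1) hi
    rw [pow_succ] at hV1 hV2
    refine ⟨by simp only [Expr.eval]; omega, ?_⟩
    refine (Runs.assign_seq hs' (by decide) ?_ fun hs₁ =>
      Runs.seq (T₂ := 15) (rowUpdate_runs hs₁ (ℓ := ℓ) (i := i) (n := n) (K := K) (A := A) (g := g)
      ?_ hi ?_ ?_ ?_ ?_ hl hK (hV _ hi))
      fun s₁ hs₂ hf₁ h6₁ => ?_).mono ?_ fun _ _ _ h => h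
    · simp [Expr.eval, h13', h13, hK]
    · simpa [a4, a5] using hA
    · simp [h1', h1]
    · simp [h14']
    · simp [Expr.eval, h13', h13]
    · simpa using h6'
    · have b0 : s₁.var 0 = n := (hf₁.var 0).trans (by simp [h0', h0])
      have b7 : s₁.var 7 = T := (hf₁.var 7).trans (by simp [h7', h7])
      have b8 : s₁.var 8 = D := (hf₁.var 8).trans (by simp [h8', h8])
      have b14 : s₁.var 14 = i := (hf₁.var 14).trans (by simp [h14'])
      have b18 : s₁.var 18 = (D * T) ^ i := (hf₁.var 18).trans (by simp [h18'])
      have b20 : s₁.var 20 = T ^ i := (hf₁.var 20).trans (by simp [h20'])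
      refine (Runs.assign_seq hs₂ (by decide) ?_ fun hs₃ => Runs.assign_seq hs₃ (by decide) ?_
        fun hs₄ => Runs.assign hs₄ (by decide) ?_ ?_).mono (by decide) fun _ _ _ h => h
      · simpa [Expr.eval, b18, b7, b8] using hV1
      · simpa [Expr.eval, b20, b7] using hV2
      · simp [Expr.eval, b14]; omega
      · exact ⟨by simp [Expr.eval, b14], by simpa using h6₁,
          by simp [Expr.eval, b18, b7, b8, pow_succ], by simp [Expr.eval, b20, b7, pow_succ]⟩
    · simp only [Expr.ops]; omega
  · rintro s' hs' hfr ⟨h14', -, -⟩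
    have h0' := hfr.var 0
    simp only [Expr.eval]
    omega

theorem power_runs {V m K : ℕ} {s : Store} (hs : Bounded V s)
    (h4 : s.var 4 = m) (h13 : s.var 13 = K) (h6 : s.var 6 = 0) (h19 : s.var 19 = 1)
    (hK : K ≤ V) (hV : ∀ i ≤ K, m ^ i ≤ V) :
    Runs V power s (K * 20 + 4) (fun s' => s'.var 19 = m ^ K) := by
  refine (Runs.loop (T := 16) K (fun i s' => s'.var 6 = i ∧ s'.var 19 = m ^ i) hs
    (by decide) ⟨h6, by simpa using h19⟩ ?_ ?_).mono
      (Nat.add_le_add (Nat.mul_le_mul_left _ (by simp only [Expr.ops]; omega)) (by decide)) fun s' _ _ h => h.2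
  · rintro i s' hi hs' hfr ⟨h6', h19'⟩
    have h4' := hfr.var 4
    have h13' := hfr.var 13
    have hV1 := hV (i + 1) hi
    rw [pow_succ] at hV1
    refine ⟨by simp only [Expr.eval]; omega, ?_⟩
    refine (Runs.assign_seq hs' (by decide) ?_ fun hs₁ => Runs.assign hs₁ (by decide) ?_
      ?_).mono (by decide) fun _ _ _ h => h
    · simpa [Expr.eval, h19', h4', h4] using hV1
    · simp [Expr.eval, h6']; omega
    · exact ⟨by simp [Expr.eval, h6'], by simp [Expr.eval, h19', h4', h4, pow_succ]⟩
  · rintro s' hs' hfr ⟨h6', -⟩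
    have h13' := hfr.var 13
    simp only [Expr.eval]
    omega

/-- Variable `19` runs through `ρ ^ i`, scaled by `m ^ K` to remain integral. -/
theorem total_runs {V m K R : ℕ} {s : Store} (hs : Bounded V s) {W : ℕ → ℕ} (hm : 0 < m)
    (hW : ∀ j < K, s.arr 6 j = W j) (h0 : s.var 0 = 0)
    (h4 : s.var 4 = m) (h13 : s.var 13 = K) (h6 : s.var 6 = 0) (h19 : s.var 19 = m ^ K)
    (h20 : s.var 20 = R) (hK : K ≤ V) (hV : ∀ i ≤ K, (m + 1) ^ i * m ^ (K - i) ≤ V)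
    (hV' : ∑ j ∈ range K, W j * min R ((m + 1) ^ j * m ^ (K - j)) ≤ V) :
    Runs V total s (K * 40 + 4) (fun s' =>
      s'.var 0 = ∑ j ∈ range K, W j * min R ((m + 1) ^ j * m ^ (K - j))) := by
  refine (Runs.loop (T := 36) K (fun i s' => s'.var 6 = i ∧
    s'.var 19 = (m + 1) ^ i * m ^ (K - i) ∧
    s'.var 0 = ∑ j ∈ range i, W j * min R ((m + 1) ^ j * m ^ (K - j))) hs
    (by decide) ⟨h6, by simpa using h19, by simpa using h0⟩ ?_ ?_).mono
      (Nat.add_le_add (Nat.mul_le_mul_left _ (by simp only [Expr.ops]; omega)) (by decide)) fun s' _ _ h => h.2.2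
  · rintro i s' hi hs' hfr ⟨h6', h19', h0'⟩
    have h4' := hfr.var 4
    have h13' := hfr.var 13
    have h20' := hfr.var 20
    have a6 := hfr.arr 6
    have hV1 := hV (i + 1) hi
    have hsum := sum_range_le_of_le (k := i + 1) hi hV'
    rw [sum_range_succ] at hsum
    -- The division is exact, since a factor `m` is left as long as `i < K`.
    have hdiv : (m + 1) ^ i * m ^ (K - i) * (m + 1) / m = (m + 1) ^ (i + 1) * m ^ (K - (i + 1)) := by
      refine Nat.div_eq_of_eq_mul_left hm ?_
      rw [show K - i = K - (i + 1) + 1 by omega]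
      ring
    refine ⟨by simp only [Expr.eval]; omega, ?_⟩
    refine (Runs.assign_seq hs' (by decide) ?_ fun hs₁ => Runs.assign_seq hs₁ (by decide) ?_
      fun hs₂ => Runs.assign hs₂ (by decide) ?_ ?_).mono (by decide) fun _ _ _ h => h
    · simpa [Expr.eval, h0', h6', h19', h20', h20, a6, hW i hi] using hsum
    · simpa [Expr.eval, h19', h4', h4, hdiv] using hV1
    · simp [Expr.eval, h6']; omega
    · exact ⟨by simp [Expr.eval, h6'], by simp [Expr.eval, h19', h4', h4, hdiv],
        by simp [Expr.eval, h0', h6', h19', h20', h20, a6, hW i hi, sum_range_succ]⟩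
  · rintro s' hs' hfr ⟨h6', -, -⟩
    have h13' := hfr.var 13
    simp only [Expr.eval]
    omega

theorem prepare_runs {V n ℓ en ed N m D T : ℕ} {s : Store} (hs : Bounded V s)
    {A g : ℕ → ℕ} (hn : 0 < n)
    (h0 : s.var 0 = n) (h1 : s.var 1 = ℓ) (h2 : s.var 2 = en) (h3 : s.var 3 = ed)
    (hvar : ∀ v, 4 ≤ v → s.var v = 0)
    (hm : m = 2 * n * (ed / en + 1)) (hN : N = n * ℓ)
    (hT : T = (range N).sup
      (fun k => max (s.arr 1 k / s.arr 0 k + 1) (s.arr 3 k / s.arr 2 k + 1)))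
    (hD : D = ∏ k ∈ range N, s.arr 1 k)
    (hA : ∀ k, A k = entryMass D (s.arr 0 k) (s.arr 1 k) (s.arr 2 k))
    (hg : ∀ k, g k = level m (s.arr 0 k * s.arr 3 k) (s.arr 2 k * s.arr 1 k * T))
    (hmV : m ≤ V) (hNV : N ≤ V) (hTV : T ≤ V) (hDV : ∀ k ≤ N, ∏ i ∈ range k, s.arr 1 i ≤ V)
    (hAV : ∀ k < N, A k ≤ V)
    (hgV : ∀ k < N, ∀ i ≤ g k, s.arr 0 k * s.arr 3 k * (m + 1) ^ i ≤ V ∧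
      s.arr 2 k * s.arr 1 k * T * m ^ i ≤ V)
    (hKV : n * (range N).sup g + 1 ≤ V) :
    Runs V prepare s (N * 160 + N * ((range N).sup g * 40) + 40)
      (fun s' => (∀ k < N, s'.arr 4 k = A k ∧ s'.arr 5 k = g k) ∧ s'.var 4 = m ∧ s'.var 7 = T ∧
        s'.var 8 = D ∧ s'.var 13 = n * (range N).sup g + 1) := by
  have hm0 : 0 < m := by rw [hm]; positivity
  have hV1 : 1 ≤ V := hm0.trans_le hmV
  have hGV : (range N).sup g ≤ V :=
    (Nat.le_mul_of_pos_left _ hn).trans ((Nat.le_succ _).trans hKV)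
  refine (Runs.assign_seq hs (by decide) ?_ fun hs₁ => Runs.assign_seq hs₁ (by decide) ?_ fun hs₂ =>
    Runs.assign_seq hs₂ (by decide) ?_ fun hs₃ =>
    Runs.seq (T₂ := N * (100 + (range N).sup g * 40) + 15)
      (scan_runs hs₃ (N := N) ?_ ?_ ?_ ?_ hNV ?_ ?_) fun t hs₄ f₁ hp => ?_).mono ?_
      fun _ _ _ h => h
  · simpa [Expr.eval, h0, h2, h3, ← hm] using hmV
  · simpa [Expr.eval, h0, h1, ← hN] using hNV
  · simpa [Expr.eval] using hV1
  · simp [Expr.eval, h0, h1, hN]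
  · simp [hvar]
  · simp [hvar]
  · simp [Expr.eval]
  · simpa only [Store.setVar_arr, ← hT] using hTV
  · simpa only [Store.setVar_arr] using hDV
  · simp only [Store.setVar_arr, ← hT, ← hD] at hp
    obtain ⟨b7, b8⟩ := hp
    have b0 : t.var 0 = n := (f₁.var 0).trans (by simp [h0])
    have b4 : t.var 4 = m := (f₁.var 4).trans (by simp [Expr.eval, h0, h2, h3, hm])
    have b5 : t.var 5 = N := (f₁.var 5).trans (by simp [Expr.eval, h0, h1, hN])
    have b12 : t.var 12 = 0 := (f₁.var 12).trans (by simp [hvar])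
    have a0 : t.arr 0 = s.arr 0 := (f₁.arr 0).trans (by simp)
    have a1 : t.arr 1 = s.arr 1 := (f₁.arr 1).trans (by simp)
    have a2 : t.arr 2 = s.arr 2 := (f₁.arr 2).trans (by simp)
    have a3 : t.arr 3 = s.arr 3 := (f₁.arr 3).trans (by simp)
    refine (Runs.assign_seq hs₄ (by decide) ?_ fun hs₅ => Runs.seq (T₂ := 6)
      (table_runs hs₅ (N := N) (D := D) (T := T) (A := A) (g := g) hm0 ?_ ?_ ?_ ?_ ?_ ?_ ?_ ?_
        hNV hAV (fun k hk => (le_sup (mem_range.2 hk)).trans hGV) ?_) fun u hs₆ f₂ hp => ?_).mono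
        ?_ fun _ _ _ h => h
    · simp [Expr.eval]
    · simpa [a0, a1, a2] using hA
    · simpa [a0, a1, a2, a3] using hg
    · simp [b4]
    · simp [b5]
    · simp [Expr.eval]
    · simp [b7]
    · simp [b8]
    · simp [b12]
    · simpa [a0, a1, a2, a3] using hgV
    · have c0 : u.var 0 = n := (f₂.var 0).trans (by simp [b0])
      have c4 : u.var 4 = m := (f₂.var 4).trans (by simp [b4])
      have c7 : u.var 7 = T := (f₂.var 7).trans (by simp [b7])
      have c8 : u.var 8 = D := (f₂.var 8).trans (by simp [b8])
      refine Runs.assign hs₆ (by decide) ?_ ?_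
      · simpa only [Expr.eval, c0, hp.2] using hKV
      · exact ⟨hp.1, by simp [c4], by simp [c7], by simp [c8], by simp [Expr.eval, c0, hp.2]⟩
    · simp only [Expr.ops]
      omega
  · simp only [Expr.ops]
    rw [mul_add]
    omega

theorem distribute_runs {V ℓ n K D T : ℕ} {s : Store} (hs : Bounded V s) {A g : ℕ → ℕ}
    (hA : ∀ k < n * ℓ, s.arr 4 k = A k ∧ s.arr 5 k = g k)
    (h0 : s.var 0 = n) (h1 : s.var 1 = ℓ) (h7 : s.var 7 = T) (h8 : s.var 8 = D)
    (h13 : s.var 13 = K) (h14 : s.var 14 = 0) (h6 : s.arr 6 = fun _ => 0) (hV1 : 1 ≤ V)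
    (hV : ∀ i ≤ n, ∀ j < K, (levelPoly A g ℓ i).coeff j ≤ V)
    (hDT : ∀ i ≤ n, (D * T) ^ i ≤ V ∧ T ^ i ≤ V) :
    Runs V distribute s (n * (K * (ℓ * 50 + 20) + 25) + 11)
      (fun s' => (∀ j < K, s'.arr 6 j = (levelPoly A g ℓ n).coeff j) ∧
        s'.var 18 = (D * T) ^ n ∧ s'.var 20 = T ^ n) := by
  refine (Runs.write_seq hs (by decide) (by decide) ?_ fun hs₁ =>
    Runs.assign_seq hs₁ (by decide) ?_ fun hs₂ => Runs.assign_seq hs₂ (by decide) ?_ fun hs₃ =>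
    allRows_runs hs₃ (ℓ := ℓ) (n := n) (K := K) (D := D) (T := T) (A := A) (g := g)
    ?_ ?_ ?_ ?_ ?_ ?_ ?_ ?_ ?_ ?_ (h0 ▸ hs.var 0) (h1 ▸ hs.var 1) (h13 ▸ hs.var 13) hV hDT).mono
    (by simp only [Expr.ops]; omega) fun _ _ _ h => h
  · simpa [Expr.eval] using hV1
  · simpa [Expr.eval] using hV1
  · simpa [Expr.eval] using hV1
  · simpa using hA
  · simp [h0]
  · simp [h1]
  · simp [h7]
  · simp [h8]
  · simp [h13]
  · simp [h14]
  · simp [Expr.eval]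
  · simp [Expr.eval]
  · simp [Expr.eval, h6]

theorem output_runs {V m K R E : ℕ} {s : Store} (hs : Bounded V s) {W : ℕ → ℕ} (hm : 0 < m)
    (hW : ∀ j < K, s.arr 6 j = W j) (h4 : s.var 4 = m) (h13 : s.var 13 = K) (h18 : s.var 18 = E)
    (h20 : s.var 20 = R) (hV1 : 1 ≤ V) (hR : R * m ^ K ≤ V) (hE : E * m ^ K ≤ V)
    (hV : ∀ i ≤ K, (m + 1) ^ i * m ^ (K - i) ≤ V) (hmV : ∀ i ≤ K, m ^ i ≤ V)
    (hsum : ∑ j ∈ range K, W j * min (R * m ^ K) ((m + 1) ^ j * m ^ (K - j)) ≤ V) :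
    Runs V output s (K * 60 + 30) (fun s' =>
      s'.var 0 = ∑ j ∈ range K, W j * min (R * m ^ K) ((m + 1) ^ j * m ^ (K - j)) ∧
      s'.var 1 = E * m ^ K) := by
  have hKV : K ≤ V := h13 ▸ hs.var 13
  refine (Runs.assign_seq hs (by decide) ?_ fun hs₁ => Runs.assign_seq hs₁ (by decide) ?_ fun hs₂ =>
    Runs.seq (T₂ := K * 40 + 20) (power_runs hs₂ (m := m) (K := K) ?_ ?_ ?_ ?_ hKV hmV)
    fun t hs₃ f₁ b19 => ?_).mono ?_ fun _ _ _ h => h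
  · simp [Expr.eval]
  · simpa [Expr.eval] using hV1
  · simp [h4]
  · simp [h13]
  · simp [Expr.eval]
  · simp [Expr.eval]
  · have b4 : t.var 4 = m := (f₁.var 4).trans (by simp [h4])
    have b13 : t.var 13 = K := (f₁.var 13).trans (by simp [h13])
    have b18 : t.var 18 = E := (f₁.var 18).trans (by simp [h18])
    have b20 : t.var 20 = R := (f₁.var 20).trans (by simp [h20])
    have b6 : t.arr 6 = s.arr 6 := (f₁.arr 6).trans (by simp)
    refine (Runs.assign_seq hs₃ (by decide) ?_ fun hs₄ => Runs.assign_seq hs₄ (by decide) ?_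
      fun hs₅ => Runs.assign_seq hs₅ (by decide) ?_ fun hs₆ => Runs.assign_seq hs₆ (by decide) ?_
      fun hs₇ => Runs.seq (T₂ := 2) (total_runs hs₇ (m := m) (K := K) (R := R * m ^ K) (W := W) hm
        ?_ ?_ ?_ ?_ ?_ ?_ ?_ hKV hV hsum)
      fun u hs₈ f₂ c0 => ?_).mono ?_ fun _ _ _ h => h
    · simpa [Expr.eval, b20, b19] using hR
    · simpa [Expr.eval, b18, b19] using hE
    · simp [Expr.eval]
    · simp [Expr.eval]
    · simpa [b6] using hW
    · simp [Expr.eval]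
    · simp [b4]
    · simp [b13]
    · simp [Expr.eval]
    · simp [b19]
    · simp [Expr.eval, b20, b19]
    · have c18 : u.var 18 = E * m ^ K := (f₂.var 18).trans (by simp [Expr.eval, b18, b19])
      refine Runs.assign hs₈ (by decide) ?_ ?_
      · simpa only [Expr.eval, c18] using hE
      · exact ⟨by simpa using c0, by simp [Expr.eval, c18]⟩
    · simp only [Expr.ops]
      omega
  · simp only [Expr.ops]
    omega

/-- The hypotheses ending in `V` collect size conditions that suffice for every value stored during
the run to be at most `V`; they are discharged later by one choice of `V`. -/
theorem similarity_runs {V n ℓ en ed N m D T K : ℕ} {s : Store} (hs : Bounded V s)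
    {A g : ℕ → ℕ} (hn : 0 < n)
    (h0 : s.var 0 = n) (h1 : s.var 1 = ℓ) (h2 : s.var 2 = en) (h3 : s.var 3 = ed)
    (hvar : ∀ v, 4 ≤ v → s.var v = 0) (h6 : s.arr 6 = fun _ => 0)
    (hm : m = 2 * n * (ed / en + 1)) (hN : N = n * ℓ)
    (hT : T = (range N).sup
      (fun k => max (s.arr 1 k / s.arr 0 k + 1) (s.arr 3 k / s.arr 2 k + 1)))
    (hD : D = ∏ k ∈ range N, s.arr 1 k)
    (hA : ∀ k, A k = entryMass D (s.arr 0 k) (s.arr 1 k) (s.arr 2 k))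
    (hg : ∀ k, g k = level m (s.arr 0 k * s.arr 3 k) (s.arr 2 k * s.arr 1 k * T))
    (hK : K = n * (range N).sup g + 1)
    (hmV : m ≤ V) (hNV : N ≤ V) (hTV : T ≤ V) (hDV : ∀ k ≤ N, ∏ i ∈ range k, s.arr 1 i ≤ V)
    (hAV : ∀ k < N, A k ≤ V)
    (hgV : ∀ k < N, ∀ i ≤ g k, s.arr 0 k * s.arr 3 k * (m + 1) ^ i ≤ V ∧
      s.arr 2 k * s.arr 1 k * T * m ^ i ≤ V)
    (hKV : K ≤ V) (hcV : ∀ i ≤ n, ∀ j < K, (levelPoly A g ℓ i).coeff j ≤ V)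
    (hDTV : ∀ i ≤ n, (D * T) ^ i ≤ V ∧ T ^ i ≤ V)
    (hDTmV : (D * T) ^ n * m ^ K ≤ V) (hTmV : T ^ n * m ^ K ≤ V)
    (hzV : ∀ i ≤ K, (m + 1) ^ i * m ^ (K - i) ≤ V) (hpowV : ∀ i ≤ K, m ^ i ≤ V)
    (hsumV : ∑ j ∈ range K, (levelPoly A g ℓ n).coeff j *
      min (T ^ n * m ^ K) ((m + 1) ^ j * m ^ (K - j)) ≤ V) :
    Runs V similarity s
      (N * 160 + N * ((range N).sup g * 40) + n * (K * (ℓ * 50 + 20) + 25) + K * 60 + 100)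
      (fun s' => s'.var 0 = ∑ j ∈ range K, (levelPoly A g ℓ n).coeff j *
          min (T ^ n * m ^ K) ((m + 1) ^ j * m ^ (K - j)) ∧
        s'.var 1 = (D * T) ^ n * m ^ K) := by
  have hm0 : 0 < m := by rw [hm]; positivity
  have hV1 : 1 ≤ V := hm0.trans_le hmV
  refine (Runs.seq (T₂ := n * (K * (ℓ * 50 + 20) + 25) + 11 + (K * 60 + 30))
    (prepare_runs hs hn h0 h1 h2 h3 hvar hm hN hT hD hA hg hmV hNV hTV hDV hAV hgV (hK ▸ hKV))
    fun t hs₁ f₁ ⟨b45, b4, b7, b8, b13⟩ => ?_).mono (by omega) fun _ _ _ h => h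
  rw [← hK] at b13
  subst hN
  refine Runs.seq (distribute_runs hs₁ b45 ((f₁.var 0).trans h0) ((f₁.var 1).trans h1) b7 b8 b13
    ((f₁.var 14).trans (hvar 14 (by norm_num))) ((f₁.arr 6).trans h6) hV1 hcV hDTV)
    fun u hs₂ f₂ ⟨c6, c18, c20⟩ => ?_
  exact output_runs hs₂ hm0 c6 ((f₂.var 4).trans b4) ((f₂.var 13).trans b13) c18 c20 hV1 hTmV hDTmV
    hzV hpowV hsumV

end RAM

/-! ### The approximation guarantee. -/

open Finset Polynomial in
-- Expanding the product over rows gives one monomial per point `y`. Summing against `φ` therefore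
-- regroups a sum over `ℓ ^ n` points into `K` terms.
theorem sum_coeff_levelPoly {n ℓ K : ℕ} (A g : ℕ → ℕ) (φ : ℕ → ℕ)
    (hK : ∀ y : Fin n → Fin ℓ, ∑ i, g (ℓ * i + y i) < K) :
    ∑ j ∈ range K, (levelPoly A g ℓ n).coeff j * φ j =
      ∑ y : Fin n → Fin ℓ, (∏ i, A (ℓ * i + y i)) * φ (∑ i, g (ℓ * i + y i)) := by
  have h : levelPoly A g ℓ n = ∑ y : Fin n → Fin ℓ,
      C (∏ i, A (ℓ * i + y i)) * X ^ (∑ i, g (ℓ * i + y i)) := by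
    rw [levelPoly, Finset.prod_range]
    simp_rw [Finset.sum_range]
    rw [Finset.prod_univ_sum, Fintype.piFinset_univ]
    refine sum_congr rfl fun y _ => ?_
    rw [prod_mul_distrib, prod_pow_eq_pow_sum, map_prod]
  simp_rw [h, finsetSum_coeff, coeff_C_mul, coeff_X_pow, sum_mul]
  rw [sum_comm]
  refine sum_congr rfl fun y _ => ?_
  simp_rw [mul_ite, ite_mul, mul_one, mul_zero, zero_mul]
  rw [Finset.sum_ite_eq' (range K), if_pos (mem_range.2 (hK y))]

theorem cast_entryMass {D : ℕ} {p : ℚ≥0} (hD : p.den ∣ D) (q : ℚ≥0) :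
    (RAM.entryMass D p.num p.den q.num : ℚ≥0) = D * if q = 0 then 0 else p := by
  obtain ⟨c, rfl⟩ := hD
  have hp : (p.den : ℚ≥0) ≠ 0 := by exact_mod_cast p.den_ne_zero
  rw [RAM.entryMass, Nat.mul_div_cancel_left _ p.den_pos]
  split_ifs with hq
  · simp [hq]
  · have : q.num ≠ 0 := by simpa using hq
    rw [show 1 - (1 - q.num) = 1 by omega, one_mul]
    push_cast
    rw [← NNRat.mul_den_eq_num p]
    ring

/-- For a positive level, minimality makes the defining inequality fail one step below it. At level
zero there is no such step, and the hypothesis `p ≤ q * T` is what is needed. -/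
theorem le_mul_level {m T : ℕ} (hm : 0 < m) {p q : ℚ≥0} (h1 : p ≤ q * T) :
    p * ((m + 1 : ℚ≥0) / m) ^ level m (p.num * q.den) (q.num * p.den * T) ≤ q * T := by
  have hm' : (m : ℚ≥0) ≠ 0 := by positivity
  have hp : (p.den : ℚ≥0) ≠ 0 := by exact_mod_cast p.den_ne_zero
  have hq : (q.den : ℚ≥0) ≠ 0 := by exact_mod_cast q.den_ne_zero
  rcases Nat.eq_zero_or_pos (level m (p.num * q.den) (q.num * p.den * T)) with h0 | h0
  · rwa [h0, pow_zero, mul_one]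
  · obtain ⟨g, hg⟩ := Nat.exists_eq_succ_of_ne_zero h0.ne'
    obtain ⟨-, h⟩ := not_of_lt_level (hg ▸ Nat.lt_succ_self g)
    rw [hg, Nat.succ_eq_add_one]
    have h' : (p.num : ℚ≥0) * q.den * (m + 1) ^ (g + 1) ≤ q.num * p.den * T * m ^ (g + 1) := by
      exact_mod_cast h
    rw [← NNRat.mul_den_eq_num p, ← NNRat.mul_den_eq_num q] at h'
    rw [div_pow, mul_div_assoc', div_le_iff₀ (by positivity)]
    refine le_of_mul_le_mul_right ?_ (show 0 < (p.den : ℚ≥0) * q.den by positivity)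
    convert h' using 1 <;> ring

/-- The defining inequality of the level, with denominators cleared: rounding down loses at most one
factor `1 + 1/m`. -/
theorem mul_le_mul_level {m T : ℕ} (hm : 0 < m) {p q : ℚ≥0} (hp0 : p ≠ 0) :
    q * T ≤ (m + 1 : ℚ≥0) / m *
      (p * ((m + 1 : ℚ≥0) / m) ^ level m (p.num * q.den) (q.num * p.den * T)) := by
  have hm' : (m : ℚ≥0) ≠ 0 := by positivity
  have hp : (p.den : ℚ≥0) ≠ 0 := by exact_mod_cast p.den_ne_zero
  have hq : (q.den : ℚ≥0) ≠ 0 := by exact_mod_cast q.den_ne_zero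
  have ha : p.num * q.den ≠ 0 := mul_ne_zero (by simpa using hp0) q.den_ne_zero
  have h := (level_spec (a := p.num * q.den) (b := q.num * p.den * T) hm).resolve_left ha
  set g := level m (p.num * q.den) (q.num * p.den * T)
  have h' : (q.num : ℚ≥0) * p.den * T * m ^ (g + 1) ≤ (p.num : ℚ≥0) * q.den * (m + 1) ^ (g + 1) := by
    exact_mod_cast h.le
  rw [mul_left_comm, ← pow_succ']
  clear_value g
  rw [← NNRat.mul_den_eq_num p, ← NNRat.mul_den_eq_num q] at h'
  rw [div_pow, mul_div_assoc', le_div_iff₀ (by positivity)]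
  refine le_of_mul_le_mul_right ?_ (show 0 < (p.den : ℚ≥0) * q.den by positivity)
  convert h' using 1 <;> ring

open Finset in
-- If some `p i` or `q i` vanishes, the left side is zero. Otherwise no mass has been removed, and
-- the coordinatewise errors multiply to `ρ ^ n`.
theorem min_prod_le {n : ℕ} {ρ : ℚ≥0} (hρ : 1 ≤ ρ) {p q b : Fin n → ℚ≥0}
    (hb : ∀ i, p i = 0 ∨ q i ≤ ρ * b i) :
    min (∏ i, p i) (∏ i, q i) ≤ ρ ^ n * min (∏ i, if q i = 0 then 0 else p i) (∏ i, b i) := by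
  by_cases hq : ∃ i, q i = 0
  · obtain ⟨i, hi⟩ := hq
    rw [prod_eq_zero (f := q) (mem_univ i) hi]
    simp
  by_cases hp : ∃ i, p i = 0
  · obtain ⟨i, hi⟩ := hp
    rw [prod_eq_zero (f := p) (mem_univ i) hi]
    simp
  push Not at hp hq
  rw [mul_min_of_nonneg _ _ (by positivity)]
  refine min_le_min ?_ ?_
  · simp only [hq, if_false]
    exact le_mul_of_one_le_left (by positivity) (one_le_pow₀ hρ)
  · calc ∏ i, q i ≤ ∏ i, ρ * b i :=
          prod_le_prod (fun _ _ => by positivity) fun i _ => (hb i).resolve_left (hp i)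
      _ = _ := by rw [prod_mul_distrib]; simp

open Finset in
/-- The output of the program approximates the similarity from below. -/
theorem output_bounds {n ℓ m T D K : ℕ} (hm : 0 < m) (hT : 0 < T) (hD : 0 < D)
    (P Q : Fin n → Fin ℓ → ℚ≥0) {A g : ℕ → ℕ}
    (hA : ∀ i x, A (ℓ * (i : Fin n) + (x : Fin ℓ)) =
      RAM.entryMass D (P i x).num (P i x).den (Q i x).num)
    (hg : ∀ i x, g (ℓ * (i : Fin n) + (x : Fin ℓ)) =
      level m ((P i x).num * (Q i x).den) ((Q i x).num * (P i x).den * T))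
    (hPD : ∀ i x, (P i x).den ∣ D) (hPQ : ∀ i x, Q i x ≠ 0 → P i x ≤ Q i x * T)
    (hK : ∀ y : Fin n → Fin ℓ, ∑ i, g (ℓ * i + y i) < K) {o : ℕ}
    (ho : o = ∑ j ∈ range K, (levelPoly A g ℓ n).coeff j *
      min (T ^ n * m ^ K) ((m + 1) ^ j * m ^ (K - j))) :
    (o : ℚ≥0) / ((D * T) ^ n * m ^ K : ℕ) ≤ statSim (productDist P) (productDist Q) ∧
    statSim (productDist P) (productDist Q) ≤
      ((m + 1 : ℚ≥0) / m) ^ n * ((o : ℚ≥0) / ((D * T) ^ n * m ^ K : ℕ)) := by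
  set ρ : ℚ≥0 := (m + 1 : ℚ≥0) / m with hρ
  have hm' : (m : ℚ≥0) ≠ 0 := by positivity
  have hT' : (T : ℚ≥0) ≠ 0 := by positivity
  have hD' : (D : ℚ≥0) ≠ 0 := by positivity
  have hρ1 : 1 ≤ ρ := by
    rw [hρ, one_le_div₀ (by positivity)]
    simp
  -- The output is exactly the similarity-type sum in which each `q` is replaced by the rounded
  -- value `p * ρ ^ g / T` and `p` is dropped where `q = 0`; both bounds then hold term by term.
  have key : (o : ℚ≥0) / ((D * T) ^ n * m ^ K : ℕ) = ∑ y : Fin n → Fin ℓ,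
      min (∏ i, if Q i (y i) = 0 then 0 else P i (y i))
        (∏ i, (if Q i (y i) = 0 then 0 else P i (y i)) * ρ ^ g (ℓ * i + y i) / T) := by
    rw [ho, sum_coeff_levelPoly A g _ hK, Nat.cast_sum, sum_div]
    refine sum_congr rfl fun y _ => ?_
    set s := ∑ i, g (ℓ * i + y i) with hs
    have hsK : s < K := hK y
    have h1 : ∏ i, (if Q i (y i) = 0 then 0 else P i (y i)) * ρ ^ g (ℓ * i + y i) / T =
        (∏ i, if Q i (y i) = 0 then 0 else P i (y i)) * (ρ ^ s / T ^ n) := by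
      rw [prod_div_distrib, prod_mul_distrib, prod_pow_eq_pow_sum, prod_const, card_univ,
        Fintype.card_fin, mul_div_assoc]
    have h2 : ((∏ i, A (ℓ * i + y i) : ℕ) : ℚ≥0) =
        D ^ n * ∏ i, if Q i (y i) = 0 then 0 else P i (y i) := by
      rw [Nat.cast_prod]
      simp_rw [hA, cast_entryMass (hPD _ _)]
      rw [prod_mul_distrib, prod_const, card_univ, Fintype.card_fin]
    rw [h1, Nat.cast_mul, h2]
    generalize (∏ i, if Q i (y i) = 0 then 0 else P i (y i)) = a
    -- This is where `s < K` enters: it keeps `K - s` from being truncated.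
    have h3 : (m : ℚ≥0) ^ K = m ^ s * m ^ (K - s) := by rw [← pow_add]; congr 1; omega
    have h4 : ρ ^ s / T ^ n = (m + 1) ^ s * m ^ (K - s) / (T ^ n * m ^ K) := by
      rw [hρ, div_pow, h3]
      field_simp
    have h5 : a = a * 1 := (mul_one a).symm
    conv_rhs => rw [h5, mul_assoc, one_mul, ← mul_min_of_nonneg _ _ zero_le, h4]
    have h6 : min 1 (((m : ℚ≥0) + 1) ^ s * m ^ (K - s) / (T ^ n * m ^ K)) =
        min ((T : ℚ≥0) ^ n * m ^ K) ((m + 1) ^ s * m ^ (K - s)) / (T ^ n * m ^ K) := by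
      rw [← min_div_div_right (c := (T : ℚ≥0) ^ n * m ^ K) zero_le, div_self (by positivity)]
    rw [h6]
    push_cast
    rw [mul_pow]
    field_simp
  rw [key, statSim, mul_sum]
  constructor
  · refine sum_le_sum fun y _ => min_le_min ?_ ?_
    · refine prod_le_prod (fun _ _ => by positivity) fun i _ => ?_
      split_ifs
      exacts [zero_le, le_rfl]
    · refine prod_le_prod (fun _ _ => by positivity) fun i _ => ?_
      split_ifs with h
      · simp
      · rw [div_le_iff₀ (by positivity), hg]
        exact le_mul_level hm (hPQ _ _ h)
  · refine sum_le_sum fun y _ => min_prod_le (p := fun i => P i (y i)) (q := fun i => Q i (y i))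
      hρ1 fun i => ?_
    by_cases hp : P i (y i) = 0
    · exact Or.inl hp
    right
    split_ifs with h
    · simp [h]
    · rw [mul_div_assoc', le_div_iff₀ (by positivity), hg]
      exact mul_le_mul_level hm hp

/-! ### Table indexing and bounds for the numbers that occur. -/

open Finset

theorem flatten_apply {n ℓ : ℕ} (g : Fin n → Fin ℓ → ℕ) (i : Fin n) (x : Fin ℓ) :
    flatten g (ℓ * i + x) = g i x := by
  have h : ℓ * (i : ℕ) + x < n * ℓ := by
    rw [add_comm]
    exact (finProdFinEquiv (i, x)).isLt
  have h2 : (⟨ℓ * (i : ℕ) + x, h⟩ : Fin (n * ℓ)) = finProdFinEquiv (i, x) :=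
    Fin.ext (add_comm _ _)
  rw [flatten, dif_pos h, h2, Equiv.symm_apply_apply]

theorem exists_eq_of_lt_mul {n ℓ k : ℕ} (hk : k < n * ℓ) :
    ∃ (i : Fin n) (x : Fin ℓ), k = ℓ * i + x := by
  refine ⟨(finProdFinEquiv.symm ⟨k, hk⟩).1, (finProdFinEquiv.symm ⟨k, hk⟩).2, ?_⟩
  have h := congrArg Fin.val (finProdFinEquiv.apply_symm_apply (⟨k, hk⟩ : Fin (n * ℓ)))
  rw [finProdFinEquiv_apply_val] at h
  simp only at h
  omega

theorem mul_add_lt_mul {n ℓ : ℕ} (i : Fin n) (x : Fin ℓ) : ℓ * (i : ℕ) + x < n * ℓ := by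
  rw [add_comm]
  exact (finProdFinEquiv (i, x)).isLt

theorem sum_range_mul (n ℓ : ℕ) (f : ℕ → ℕ) :
    ∑ k ∈ range (n * ℓ), f k = ∑ i : Fin n, ∑ x : Fin ℓ, f (ℓ * i + x) := by
  rw [sum_range, ← Fintype.sum_prod_type', ← finProdFinEquiv.sum_comp]
  exact sum_congr rfl fun z _ => congrArg f (add_comm _ _)

theorem prod_le_two_pow_sum_size (s : Finset ℕ) (f : ℕ → ℕ) :
    ∏ k ∈ s, f k ≤ 2 ^ ∑ k ∈ s, (f k).size := by
  rw [← prod_pow_eq_pow_sum]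
  exact prod_le_prod' fun k _ => (Nat.lt_size_self _).le

theorem coeff_le_eval_one (p : Polynomial ℕ) (j : ℕ) : p.coeff j ≤ p.eval 1 := by
  rw [Polynomial.eval_eq_sum_range]
  simp only [one_pow, mul_one]
  rcases le_or_gt j p.natDegree with h | h
  · exact single_le_sum (f := fun j => p.coeff j) (fun _ _ => Nat.zero_le _)
      (mem_range.2 (Nat.lt_succ_of_le h))
  · rw [Polynomial.coeff_eq_zero_of_natDegree_lt h]
    exact Nat.zero_le _

/-- A coefficient is at most the value at `1`, where each row contributes a factor at most `ℓ * B`.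
-/
theorem coeff_levelPoly_le {A g : ℕ → ℕ} {ℓ i n B : ℕ} (hi : i ≤ n)
    (hA : ∀ k < n * ℓ, A k ≤ B) (j : ℕ) : (levelPoly A g ℓ i).coeff j ≤ (ℓ * B) ^ i := by
  refine (coeff_le_eval_one _ j).trans ?_
  rw [levelPoly, Polynomial.eval_prod]
  simp only [Polynomial.eval_finsetSum, Polynomial.eval_mul, Polynomial.eval_C,
    Polynomial.eval_pow, Polynomial.eval_X, one_pow, mul_one]
  refine (prod_le_pow_card _ _ (ℓ * B) fun r hr => ?_).trans (by rw [card_range])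
  refine (sum_le_card_nsmul _ _ B fun x hx => hA _ ?_).trans (by rw [card_range, smul_eq_mul])
  rw [mem_range] at hr hx
  calc ℓ * r + x < ℓ * (r + 1) := by rw [mul_add_one]; omega
    _ ≤ ℓ * n := Nat.mul_le_mul_left _ (by omega)
    _ = n * ℓ := mul_comm _ _

namespace RAM

/-- The program on inputs whose total length is `L`. -/
theorem similarity_runs_of_length {n ℓ en ed N m D T K L Y Z : ℕ} {s : Store}
    {A g : ℕ → ℕ} (hn : 0 < n) (hℓ : 0 < ℓ)
    (h0 : s.var 0 = n) (h1 : s.var 1 = ℓ) (h2 : s.var 2 = en) (h3 : s.var 3 = ed)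
    (hvar : ∀ v, 4 ≤ v → s.var v = 0) (h6 : s.arr 6 = fun _ => 0)
    (hm : m = 2 * n * (ed / en + 1)) (hN : N = n * ℓ)
    (hT : T = (range N).sup
      (fun k => max (s.arr 1 k / s.arr 0 k + 1) (s.arr 3 k / s.arr 2 k + 1)))
    (hD : D = ∏ k ∈ range N, s.arr 1 k)
    (hA : ∀ k, A k = entryMass D (s.arr 0 k) (s.arr 1 k) (s.arr 2 k))
    (hg : ∀ k, g k = level m (s.arr 0 k * s.arr 3 k) (s.arr 2 k * s.arr 1 k * T))
    (hK : K = n * (range N).sup g + 1)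
    (hsL : ∀ a j, s.arr a j < 2 ^ L) (henL : en < 2 ^ L) (hedL : ed < 2 ^ L)
    (hL : ∑ k ∈ range N, (s.arr 1 k).size ≤ L) (hNL : N ≤ L)
    (hY : Y = 3 * L + m) (hZ : Z = K + 2 * (Y * n) + Y * K + 2 * Y) :
    T ≤ 2 ^ (L + 1) ∧ Runs (2 ^ Z) similarity s (455 * (N * K))
      (fun s' => s'.var 0 = ∑ j ∈ range K, (levelPoly A g ℓ n).coeff j *
          min (T ^ n * m ^ K) ((m + 1) ^ j * m ^ (K - j)) ∧
        s'.var 1 = (D * T) ^ n * m ^ K) := by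
  have hN1 : 1 ≤ N := by rw [hN]; exact Nat.mul_pos hn hℓ
  have hK1 : 1 ≤ K := by omega
  have hnN : n ≤ N := hN ▸ Nat.le_mul_of_pos_right _ hℓ
  have hℓN : ℓ ≤ N := hN ▸ Nat.le_mul_of_pos_left _ hn
  have hL2 : L < 2 ^ L := Nat.lt_two_pow_self
  have pow_mono : ∀ {a b : ℕ}, a ≤ b → 2 ^ a ≤ 2 ^ b := fun h =>
    Nat.pow_le_pow_right (by norm_num) h
  have hKY : Y ≤ Y * K := Nat.le_mul_of_pos_right _ hK1
  have le_of_le : ∀ {x a : ℕ}, x ≤ 2 ^ a → a ≤ Z → x ≤ 2 ^ Z := fun h h' =>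
    h.trans (pow_mono h')
  have hL1 : 2 ^ L + 1 ≤ 2 ^ (L + 1) := by
    have := Nat.one_le_two_pow (n := L)
    rw [pow_succ]
    omega
  have hTL : T ≤ 2 ^ (L + 1) := by
    rw [hT]
    refine Finset.sup_le fun k _ => max_le ?_ ?_
    · exact (Nat.succ_le_succ ((Nat.div_le_self _ _).trans (hsL 1 k).le)).trans hL1
    · exact (Nat.succ_le_succ ((Nat.div_le_self _ _).trans (hsL 3 k).le)).trans hL1
  have hDL : ∀ k ≤ N, ∏ i ∈ range k, s.arr 1 i ≤ 2 ^ L := fun k hk =>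
    (prod_le_two_pow_sum_size _ _).trans (pow_mono (sum_range_le_of_le hk hL))
  have hm2 : m + 1 ≤ 2 ^ m := Nat.lt_two_pow_self
  -- `Y` is chosen so that `2 ^ Y` bounds each base raised to a power: `m + 1`, `T`, `D`, and the
  -- row sums of masses, at most `2 ^ (3 * L)`. The terms of `Z` then account for the exponents `n`
  -- and `K`.
  have hmY : m + 1 ≤ 2 ^ Y := hm2.trans (pow_mono (by omega))
  have hTY : T ≤ 2 ^ Y := hTL.trans (pow_mono (by omega))
  have hDY : D ≤ 2 ^ Y := hD ▸ (hDL N le_rfl).trans (pow_mono (by omega))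
  have hAL : ∀ k, A k ≤ 2 ^ (2 * L) := fun k => by
    rw [hA, two_mul, pow_add]
    calc _ ≤ 1 * (s.arr 0 k * (D / s.arr 1 k)) := Nat.mul_le_mul_right _ (Nat.sub_le _ _)
      _ = s.arr 0 k * (D / s.arr 1 k) := one_mul _
      _ ≤ _ := Nat.mul_le_mul (hsL 0 k).le ((Nat.div_le_self _ _).trans (hD ▸ hDL N le_rfl))
  have hgK : ∀ k < N, g k ≤ K := fun k hk => by
    have : g k ≤ (range N).sup g := le_sup (mem_range.2 hk)
    have := Nat.le_mul_of_pos_left ((range N).sup g) hn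
    omega
  have hmi : ∀ {i}, i ≤ K → (m + 1) ^ i ≤ 2 ^ (Y * K) := fun {i} hi => by
    rw [pow_mul 2 Y]
    exact (Nat.pow_le_pow_left hmY i).trans (Nat.pow_le_pow_right (by positivity) hi)
  have hmi' : ∀ {i}, i ≤ K → m ^ i ≤ 2 ^ (Y * K) := fun {i} hi =>
    (Nat.pow_le_pow_left (Nat.le_succ m) i).trans (hmi hi)
  have hTi : ∀ {i}, i ≤ n → T ^ i ≤ 2 ^ (Y * n) := fun {i} hi => by
    rw [pow_mul 2 Y]
    exact (Nat.pow_le_pow_left hTY i).trans (Nat.pow_le_pow_right (by positivity) hi)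
  have hDi : ∀ {i}, i ≤ n → D ^ i ≤ 2 ^ (Y * n) := fun {i} hi => by
    rw [pow_mul 2 Y]
    exact (Nat.pow_le_pow_left hDY i).trans (Nat.pow_le_pow_right (by positivity) hi)
  have hco : ∀ i ≤ n, ∀ j, (levelPoly A g ℓ i).coeff j ≤ 2 ^ (Y * n) := fun i hi j => by
    refine (coeff_levelPoly_le hi (fun k _ => hAL k) j).trans ?_
    rw [pow_mul 2 Y]
    refine (Nat.pow_le_pow_left (?_ : _ ≤ 2 ^ Y) i).trans
      (Nat.pow_le_pow_right (by positivity) hi)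
    calc ℓ * 2 ^ (2 * L) ≤ 2 ^ L * 2 ^ (2 * L) := Nat.mul_le_mul_right _ (by omega)
      _ = 2 ^ (3 * L) := by rw [← pow_add]; congr 1; omega
      _ ≤ 2 ^ Y := pow_mono (by omega)
  have hDT : ∀ {i}, i ≤ n → (D * T) ^ i ≤ 2 ^ (Y * n + Y * n) := fun {i} hi => by
    rw [mul_pow, pow_add]
    exact Nat.mul_le_mul (hDi hi) (hTi hi)
  have hTm : T ^ n * m ^ K ≤ 2 ^ (Y * n + Y * K) := by
    rw [pow_add]
    exact Nat.mul_le_mul (hTi le_rfl) (hmi' le_rfl)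
  have hbound : Bounded (2 ^ Z) s := by
    refine ⟨fun v => ?_, fun a j => le_of_le (hsL a j).le (by omega)⟩
    rcases lt_or_ge v 4 with hv | hv
    · interval_cases v
      · exact le_of_le (a := L) (by omega) (by omega)
      · exact le_of_le (a := L) (by omega) (by omega)
      · exact le_of_le (a := L) (by omega) (by omega)
      · exact le_of_le (a := L) (by omega) (by omega)
    · rw [hvar v hv]
      exact Nat.zero_le _
  refine ⟨hTL, (similarity_runs hbound hn h0 h1 h2 h3 hvar h6 hm hN hT hD hA hg hK ?_ ?_ ?_ ?_ ?_ ?_ ?_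
    ?_ ?_ ?_ ?_ ?_ ?_ ?_).mono ?_ fun _ _ _ h => h⟩
  · exact le_of_le (a := Y) (by omega) (by omega)
  · exact le_of_le (a := L) (by omega) (by omega)
  · exact le_of_le hTY (by omega)
  · exact fun k hk => le_of_le (hDL k hk) (by omega)
  · exact fun k _ => le_of_le (hAL k) (by omega)
  · refine fun k hk i hi => ⟨le_of_le (a := L + L + Y * K) ?_ (by omega),
      le_of_le (a := L + L + (L + 1) + Y * K) ?_ (by omega)⟩
    · rw [pow_add, pow_add]
      exact Nat.mul_le_mul (Nat.mul_le_mul (hsL _ _).le (hsL _ _).le) (hmi (hi.trans (hgK k hk)))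
    · rw [pow_add, pow_add, pow_add 2 L L]
      exact Nat.mul_le_mul (Nat.mul_le_mul (Nat.mul_le_mul (hsL _ _).le (hsL _ _).le) hTL)
        (hmi' (hi.trans (hgK k hk)))
  · exact le_of_le (a := K) Nat.lt_two_pow_self.le (by omega)
  · exact fun i hi j _ => le_of_le (hco i hi j) (by omega)
  · exact fun i hi => ⟨le_of_le (hDT hi) (by omega), le_of_le (hTi hi) (by omega)⟩
  · refine le_of_le (a := Y * n + Y * n + Y * K) ?_ (by omega)
    rw [pow_add]
    exact Nat.mul_le_mul (hDT le_rfl) (hmi' le_rfl)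
  · exact le_of_le hTm (by omega)
  · refine fun i hi => le_of_le (a := Y * K) ?_ (by omega)
    calc (m + 1) ^ i * m ^ (K - i) ≤ (m + 1) ^ i * (m + 1) ^ (K - i) :=
          Nat.mul_le_mul_left _ (Nat.pow_le_pow_left (Nat.le_succ m) _)
      _ = (m + 1) ^ K := by rw [← pow_add]; congr 1; omega
      _ ≤ _ := hmi le_rfl
  · exact fun i hi => le_of_le (hmi' hi) (by omega)
  · refine le_of_le (a := K + (Y * n + (Y * n + Y * K))) ?_ (by omega)
    refine (sum_le_card_nsmul _ _ (2 ^ (Y * n) * 2 ^ (Y * n + Y * K)) fun j _ =>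
      Nat.mul_le_mul (hco n le_rfl j) ((min_le_left _ _).trans hTm)).trans ?_
    rw [card_range, smul_eq_mul, pow_add 2 K, pow_add 2 (Y * n) (Y * n + Y * K)]
    exact Nat.mul_le_mul_right _ Nat.lt_two_pow_self.le
  -- Every term of the operation count is a multiple of a quantity at most `N * K`, and `455 = 160 +
  -- 40 + 50 + 20 + 25 + 60 + 100`.
  · have e1 : N * 1 ≤ N * K := Nat.mul_le_mul_left _ hK1
    have e2 : N * (range N).sup g ≤ N * K := Nat.mul_le_mul_left _ (by
      have := Nat.le_mul_of_pos_left ((range N).sup g) hn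
      omega)
    have e3 : n * K ≤ N * K := Nat.mul_le_mul_right _ hnN
    have e4 : 1 * K ≤ N * K := Nat.mul_le_mul_right _ hN1
    have e5 : n * 1 ≤ N * K := Nat.mul_le_mul hnN hK1
    have e6 : n * (K * (ℓ * 50 + 20) + 25) = 50 * (N * K) + 20 * (n * K) + 25 * n := by
      rw [hN]; ring
    have e7 : N * ((range N).sup g * 40) = 40 * (N * (range N).sup g) := by ring
    rw [e6, e7]
    omega

end RAM

/-! ### Consequences of the choice of `m` and `T`. -/

/-- Bernoulli's inequality applied to the inverse `1 - 1/(m + 1)` gives the bound `(m + 1) / (m + 1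
- n)`, which the size of `m` turns into `1 + 1/w`. -/
theorem add_one_div_pow_le {n w m : ℕ} (hn : 0 < n) (hw : 0 < w) (hm : m = 2 * n * w) :
    ((m + 1 : ℚ≥0) / m) ^ n ≤ 1 + 1 / w := by
  have hn' : (1 : ℚ) ≤ n := by exact_mod_cast hn
  have hw' : (1 : ℚ) ≤ w := by exact_mod_cast hw
  have hmq : (m : ℚ) = 2 * n * w := by exact_mod_cast hm
  have hm0 : (0 : ℚ) < m := by rw [hmq]; positivity
  have hnw : (n : ℚ) ≤ n * w := le_mul_of_one_le_right (by linarith) hw'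
  have h := one_add_mul_le_pow (a := -(1 / (m + 1 : ℚ))) (by
    have : 1 / (m + 1 : ℚ) ≤ 1 := by rw [div_le_one (by positivity)]; linarith
    linarith) n
  have e1 : 1 + -(1 / (m + 1 : ℚ)) = m / (m + 1) := by field_simp; ring
  have e2 : 1 + (n : ℚ) * -(1 / (m + 1)) = (m + 1 - n) / (m + 1) := by field_simp; ring
  rw [e1, e2] at h
  have hpos : (0 : ℚ) < (m + 1 - n) := by rw [hmq]; linarith
  have key : ((m + 1 : ℚ) / m) ^ n ≤ 1 + 1 / w := by
    calc ((m + 1 : ℚ) / m) ^ n = ((m / (m + 1 : ℚ)) ^ n)⁻¹ := by rw [← inv_pow, inv_div]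
      _ ≤ ((m + 1 - n) / (m + 1 : ℚ))⁻¹ := inv_anti₀ (by positivity) h
      _ = (m + 1 : ℚ) / (m + 1 - n) := inv_div _ _
      _ ≤ (w + 1) / w := by
        rw [div_le_div_iff₀ hpos (by positivity)]
        nlinarith
      _ = 1 + 1 / w := by field_simp
  exact_mod_cast key

/-- For `p ≠ 0`, the ratio `q * T / p` is below `T ^ 2 < 2 ^ (2 * T.size)`, because `q ≤ 1` and `1/p
< T`; each doubling takes at most `m` levels. -/
theorem level_le_of_probability {m T : ℕ} (hm : 0 < m) {p q : ℚ≥0} (hq : q ≤ 1)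
    (hT : p.den / p.num + 1 ≤ T) :
    level m (p.num * q.den) (q.num * p.den * T) ≤ m * (2 * T.size) := by
  refine level_le hm ?_
  rcases Nat.eq_zero_or_pos p.num with hp | hp
  · exact Or.inl (by simp [hp])
  right
  have h1 : p.den < T * p.num := (Nat.div_lt_iff_lt_mul hp).1 hT
  have h2 : q.num ≤ q.den := by
    have : (q.num : ℚ≥0) ≤ q.den := by
      rw [← NNRat.mul_den_eq_num q]
      exact mul_le_of_le_one_left zero_le hq
    exact_mod_cast this
  have h3 := Nat.lt_size_self T
  calc q.num * p.den * T ≤ q.den * (T * p.num) * T :=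
        Nat.mul_le_mul_right _ (Nat.mul_le_mul h2 h1.le)
    _ = p.num * q.den * (T * T) := by ring
    _ < p.num * q.den * 2 ^ (2 * T.size) := by
        refine Nat.mul_lt_mul_of_pos_left ?_ (Nat.mul_pos hp q.den_pos)
        rw [two_mul, pow_add]
        exact Nat.mul_lt_mul'' h3 h3

theorem one_le_mul_of_div_add_one_le {T : ℕ} {q : ℚ≥0} (hq : q ≠ 0)
    (hT : q.den / q.num + 1 ≤ T) : 1 ≤ q * T := by
  have hq0 : 0 < q.num := Nat.pos_of_ne_zero (by simpa using hq)
  have h1 : q.den < T * q.num := (Nat.div_lt_iff_lt_mul hq0).1 hT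
  have h2 : (q.den : ℚ≥0) ≤ T * (q * q.den) := by
    rw [NNRat.mul_den_eq_num]
    exact_mod_cast h1.le
  refine le_of_mul_le_mul_right ?_ (show 0 < (q.den : ℚ≥0) by exact_mod_cast q.den_pos)
  calc _ = (q.den : ℚ≥0) := one_mul _
    _ ≤ _ := h2
    _ = _ := by ring

theorem flatten_lt {n ℓ B : ℕ} {g : Fin n → Fin ℓ → ℕ} (hB : 0 < B) (h : ∀ i x, g i x < B)
    (k : ℕ) : flatten g k < B := by
  rw [flatten]
  split_ifs
  exacts [h _ _, hB]

section Length

variable {n ℓ : ℕ} (P Q : Fin n → Fin ℓ → ℚ≥0) (ε : ℚ≥0)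

theorem entry_size_le (i : Fin n) (x : Fin ℓ) :
    (P i x).num.size + (P i x).den.size + (Q i x).num.size + (Q i x).den.size ≤
      inputLength P Q ε := by
  have h1 := single_le_sum (s := univ) (f := fun x => (P i x).num.size + (P i x).den.size +
    (Q i x).num.size + (Q i x).den.size) (fun _ _ => Nat.zero_le _) (mem_univ x)
  have h2 := single_le_sum (s := univ) (f := fun i => ∑ x, ((P i x).num.size + (P i x).den.size +
    (Q i x).num.size + (Q i x).den.size)) (fun _ _ => Nat.zero_le _) (mem_univ i)
  rw [inputLength]
  omega

theorem inputStore_arr_lt (a j : ℕ) :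
    (inputStore P Q ε).arr a j < 2 ^ inputLength P Q ε := by
  have hpos : 0 < 2 ^ inputLength P Q ε := by positivity
  have lt_of {k : ℕ} (h : k.size ≤ inputLength P Q ε) : k < 2 ^ inputLength P Q ε :=
    Nat.size_le.1 h
  have hsize := entry_size_le P Q ε
  match a with
  | 0 => exact flatten_lt hpos (fun i x => lt_of (k := (P i x).num) (by have := hsize i x; omega)) j
  | 1 => exact flatten_lt hpos (fun i x => lt_of (k := (P i x).den) (by have := hsize i x; omega)) j
  | 2 => exact flatten_lt hpos (fun i x => lt_of (k := (Q i x).num) (by have := hsize i x; omega)) j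
  | 3 => exact flatten_lt hpos (fun i x => lt_of (k := (Q i x).den) (by have := hsize i x; omega)) j
  | _ + 4 => exact hpos

theorem sum_size_den_le :
    ∑ k ∈ range (n * ℓ), ((inputStore P Q ε).arr 1 k).size ≤ inputLength P Q ε := by
  rw [sum_range_mul]
  refine le_trans (sum_le_sum fun i _ => sum_le_sum fun x _ => ?_) (Nat.le_add_left _ _)
  rw [show (inputStore P Q ε).arr 1 = flatten fun i x => (P i x).den from rfl, flatten_apply]
  omega

theorem mul_le_inputLength : n * ℓ ≤ inputLength P Q ε := by
  have h : n * ℓ = ∑ _i : Fin n, ∑ _x : Fin ℓ, 1 := by simp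
  rw [h]
  refine le_trans (sum_le_sum fun i _ => sum_le_sum fun x _ => ?_) (Nat.le_add_left _ _)
  have : 0 < (P i x).den.size := Nat.size_pos.2 (P i x).den_pos
  omega

end Length

/-! ### Cost estimates. -/

/-- In powers of `x`, the degrees are `2` for `m` and `Y`, `3` for `G`, `4` for `K` and `6` for `Z`.
The exponent is `11 = 1 + 4 + 6`, from `N * K` operations of cost `O(Z)`. -/
theorem bit_cost_bound {x : ℝ} {n N L w m S G K Y Z t b : ℕ} (hx : 1 ≤ x) (hL : (L : ℝ) ≤ x)
    (hn : n ≤ L) (hN : N ≤ L) (hw : (w : ℝ) ≤ x + 1) (hm : m = 2 * n * w) (hS : S ≤ L + 2)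
    (hG : G ≤ m * (2 * S)) (hK : K = n * G + 1) (hY : Y = 3 * L + m)
    (hZ : Z = K + 2 * (Y * n) + Y * K + 2 * Y) (ht : t ≤ 455 * (N * K))
    (hb : b ≤ t * RAM.opCost (2 ^ Z)) : (b : ℝ) ≤ 1000000000 * x ^ 11 := by
  have hn' : (n : ℝ) ≤ x := le_trans (by exact_mod_cast hn) hL
  have hN' : (N : ℝ) ≤ x := le_trans (by exact_mod_cast hN) hL
  have hS' : (S : ℝ) ≤ 3 * x := by
    have : (S : ℝ) ≤ L + 2 := by exact_mod_cast hS
    linarith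
  have pow_le {a b : ℕ} (h : a ≤ b) : x ^ a ≤ x ^ b := pow_le_pow_right₀ hx h
  have hm' : (m : ℝ) ≤ 4 * x ^ 2 := by
    rw [hm]
    push_cast
    calc 2 * (n : ℝ) * w ≤ 2 * x * (2 * x) := by gcongr; linarith
      _ = _ := by ring
  have hG' : (G : ℝ) ≤ 24 * x ^ 3 := by
    calc (G : ℝ) ≤ m * (2 * S) := by exact_mod_cast hG
      _ ≤ 4 * x ^ 2 * (2 * (3 * x)) := by gcongr
      _ = _ := by ring
  have hK' : (K : ℝ) ≤ 25 * x ^ 4 := by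
    rw [hK]
    push_cast
    have : (n : ℝ) * G ≤ x * (24 * x ^ 3) := by gcongr
    have := one_le_pow₀ hx (n := 4)
    nlinarith
  have hY' : (Y : ℝ) ≤ 7 * x ^ 2 := by
    rw [hY]
    push_cast
    have := pow_le (a := 1) (b := 2) (by norm_num)
    linarith
  have hZ' : (Z : ℝ) ≤ 228 * x ^ 6 := by
    rw [hZ]
    push_cast
    have h1 : (Y : ℝ) * n ≤ 7 * x ^ 2 * x := by gcongr
    have h2 : (Y : ℝ) * K ≤ 7 * x ^ 2 * (25 * x ^ 4) := by gcongr
    have := pow_le (a := 2) (b := 6) (by norm_num)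
    have := pow_le (a := 3) (b := 6) (by norm_num)
    have := pow_le (a := 4) (b := 6) (by norm_num)
    nlinarith
  have hc : (RAM.opCost (2 ^ Z) : ℝ) ≤ 9201 * x ^ 6 := by
    rw [RAM.opCost, Nat.size_pow]
    push_cast
    have := one_le_pow₀ hx (n := 6)
    linarith
  calc (b : ℝ) ≤ t * RAM.opCost (2 ^ Z) := by exact_mod_cast hb
    _ ≤ 455 * (N * K) * RAM.opCost (2 ^ Z) := by gcongr; exact_mod_cast ht
    _ ≤ 455 * (x * (25 * x ^ 4)) * (9201 * x ^ 6) := by gcongr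
    _ = 104661375 * x ^ 11 := by ring
    _ ≤ _ := by gcongr; norm_num

theorem size_le_one_add_logb {T : ℕ} (hT : 0 < T) : (T.size : ℝ) ≤ 1 + Real.logb 2 T := by
  obtain ⟨j, hj⟩ := Nat.exists_eq_succ_of_ne_zero (Nat.size_pos.2 hT).ne'
  have h : 2 ^ j ≤ T := Nat.lt_size.1 (by omega)
  have h' : (2 : ℝ) ^ j ≤ T := by exact_mod_cast h
  have := Real.logb_le_logb_of_le (b := 2) (by norm_num) (by positivity) h'
  rw [Real.logb_pow, Real.logb_self_eq_one (by norm_num), mul_one] at this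
  rw [hj]
  push_cast
  linarith

/-- Since `T ≤ 2/τ`, its length is at most `2 * lam`, so `K` is `O(n ^ 2 * lam / e)` and the count
is even linear in `timeScale`. The logarithmic factor is at least `1` and enters only at the end. -/
theorem time_bound {n ℓ T w m G K t k : ℕ} {e τ : ℝ} (hn : 0 < n) (hℓ : 0 < ℓ) (hT0 : 0 < T)
    (he : 0 < e) (he1 : e ≤ 1) (hτ : 0 < τ) (hτ1 : τ ≤ 1) (hT : (T : ℝ) ≤ 2 / τ)
    (hw : (w : ℝ) ≤ 2 / e) (hm : m = 2 * n * w) (hG : G ≤ m * (2 * T.size)) (hK : K = n * G + 1)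
    (ht : t ≤ 455 * (n * ℓ * K)) :
    (t : ℝ) ≤ 1000000000 * timeScale n ℓ e τ * (1 + Real.logb 2 (timeScale n ℓ e τ)) ^ k := by
  have hn' : (1 : ℝ) ≤ n := by exact_mod_cast hn
  have hℓ' : (1 : ℝ) ≤ ℓ := by exact_mod_cast hℓ
  set lam := Real.logb 2 ((1 + e) / (e * τ)) with hlam
  have h2τ : 2 / τ ≤ (1 + e) / (e * τ) := by
    rw [div_le_div_iff₀ hτ (by positivity)]
    nlinarith
  have hl2 : Real.logb 2 (2 / τ) ≤ lam :=
    Real.logb_le_logb_of_le (by norm_num) (by positivity) h2τ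
  have hl1 : 1 ≤ lam := by
    refine le_trans ?_ hl2
    rw [Real.le_logb_iff_rpow_le (by norm_num) (by positivity), Real.rpow_one,
      le_div_iff₀ hτ]
    linarith
  have hsz : (T.size : ℝ) ≤ 2 * lam := by
    have h1 := size_le_one_add_logb hT0
    have h2 := Real.logb_le_logb_of_le (b := 2) (by norm_num) (by exact_mod_cast hT0) hT
    linarith
  have hF : timeScale n ℓ e τ = (n : ℝ) ^ 3 * ℓ * lam / e := rfl
  have hu : (1 : ℝ) ≤ n ^ 2 * lam / e := by
    rw [le_div_iff₀ he, one_mul]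
    have := one_le_pow₀ hn' (n := 2)
    nlinarith
  have hK' : (K : ℝ) ≤ 17 * (n ^ 2 * lam / e) := by
    have h1 : (G : ℝ) ≤ 2 * n * (2 / e) * (2 * (2 * lam)) := by
      calc (G : ℝ) ≤ m * (2 * T.size) := by exact_mod_cast hG
        _ = 2 * n * w * (2 * T.size) := by rw [hm]; push_cast; ring
        _ ≤ _ := by gcongr
    have h2 : (n : ℝ) * G ≤ n * (2 * n * (2 / e) * (2 * (2 * lam))) := by gcongr
    have h3 : (n : ℝ) * (2 * n * (2 / e) * (2 * (2 * lam))) = 16 * (n ^ 2 * lam / e) := by ring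
    rw [hK]
    push_cast
    linarith
  have hF1 : 1 ≤ timeScale n ℓ e τ := by
    have : timeScale n ℓ e τ = n * ℓ * (n ^ 2 * lam / e) := by rw [hF]; ring
    rw [this]
    exact one_le_mul_of_one_le_of_one_le (one_le_mul_of_one_le_of_one_le hn' hℓ') hu
  have hlog : 0 ≤ Real.logb 2 (timeScale n ℓ e τ) := Real.logb_nonneg (by norm_num) hF1
  calc (t : ℝ) ≤ 455 * (n * ℓ * K) := by exact_mod_cast ht
    _ ≤ 455 * (n * ℓ * (17 * (n ^ 2 * lam / e))) := by gcongr
    _ = 7735 * timeScale n ℓ e τ := by rw [hF]; ring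
    _ ≤ 1000000000 * timeScale n ℓ e τ * 1 := by linarith
    _ ≤ _ := by
      gcongr
      exact one_le_pow₀ (by linarith)

theorem natCast_div_add_one_le {p : ℚ≥0} {τ : ℝ} (hτ : 0 < τ) (hτ1 : τ ≤ 1)
    (hp : p ≠ 0 → τ ≤ (p : ℝ)) : ((p.den / p.num + 1 : ℕ) : ℝ) ≤ 2 / τ := by
  have h1 : 1 ≤ 1 / τ := by rwa [le_div_iff₀ hτ, one_mul]
  have h2 : ((p.den / p.num : ℕ) : ℝ) ≤ 1 / τ := by
    by_cases h : p = 0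
    · simp [h]
      positivity
    · refine Nat.cast_div_le.trans ?_
      have e : (p : ℝ) = p.num / p.den := by
        conv_lhs => rw [← NNRat.num_div_den p]
        push_cast
        rfl
      rw [← one_div_div, ← e]
      exact one_div_le_one_div_of_le hτ (hp h)
  push_cast at *
  have : 2 / τ = 1 / τ + 1 / τ := by ring
  linarith

theorem theorem1 :
    ∃ (prog : RAM.Cmd) (C k : ℕ),
      ∀ (n ℓ : ℕ) (P Q : Fin n → Fin ℓ → ℚ≥0) (ε : ℚ≥0),
        0 < n → (∀ i, ∑ x, P i x = 1) → (∀ i, ∑ x, Q i x = 1) → 0 < ε →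
        ∃ (s : RAM.Store) (t b : ℕ),
          -- the program halts, after `t` operations of total logarithmic cost `b`
          RAM.Exec prog (inputStore P Q ε) s t b ∧
          -- its output is a `(1 + ε)`-multiplicative approximation of the similarity
          0 < s.var 1 ∧
          statSim (productDist P) (productDist Q) / (1 + ε) ≤ outputValue s ∧
          outputValue s ≤ (1 + ε) * statSim (productDist P) (productDist Q) ∧
          -- the bit cost is polynomial in the length of the input and `1 / ε`
          (b : ℝ) ≤ C * ((inputLength P Q ε : ℝ) + 1 / (ε : ℝ)) ^ k ∧
          -- the number of operations, up to polylogarithmic factors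
          (∀ τ : ℝ, 0 < τ →
            (∀ i x, P i x ≠ 0 → τ ≤ (P i x : ℝ)) → (∀ i x, Q i x ≠ 0 → τ ≤ (Q i x : ℝ)) →
            (t : ℝ) ≤ C * timeScale n ℓ (min (ε : ℝ) 1) τ *
              (1 + Real.logb 2 (timeScale n ℓ (min (ε : ℝ) 1) τ)) ^ k) := by

  refine ⟨RAM.similarity, 1000000000, 11, fun n ℓ P Q ε hn hP hQ hε => ?_⟩
  -- An empty alphabet carries no probability distribution.
  have hℓ : 0 < ℓ := by
    rcases Nat.eq_zero_or_pos ℓ with rfl | h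
    · simpa using hP ⟨0, hn⟩
    · exact h
  have hP1 : ∀ i x, P i x ≤ 1 := fun i x => hP i ▸ single_le_sum (fun _ _ => zero_le) (mem_univ x)
  have hQ1 : ∀ i x, Q i x ≤ 1 := fun i x => hQ i ▸ single_le_sum (fun _ _ => zero_le) (mem_univ x)
  set s := inputStore P Q ε with hs
  set L := inputLength P Q ε with hL
  have a0 : ∀ i x, s.arr 0 (ℓ * (i : Fin n) + (x : Fin ℓ)) = (P i x).num :=
    flatten_apply fun i x => (P i x).num
  have a1 : ∀ i x, s.arr 1 (ℓ * (i : Fin n) + (x : Fin ℓ)) = (P i x).den :=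
    flatten_apply fun i x => (P i x).den
  have a2 : ∀ i x, s.arr 2 (ℓ * (i : Fin n) + (x : Fin ℓ)) = (Q i x).num :=
    flatten_apply fun i x => (Q i x).num
  have a3 : ∀ i x, s.arr 3 (ℓ * (i : Fin n) + (x : Fin ℓ)) = (Q i x).den :=
    flatten_apply fun i x => (Q i x).den
  obtain ⟨w, hw⟩ : ∃ w, w = ε.den / ε.num + 1 := ⟨_, rfl⟩
  obtain ⟨m, hm⟩ : ∃ m, m = 2 * n * w := ⟨_, rfl⟩
  -- A zero probability has numerator `0`, so its quotient is `0` by convention and it contributes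
  -- just `1` to the maximum; the summand `1` makes `T` exceed the other inverses strictly.
  obtain ⟨T, hT⟩ : ∃ T, T = (range (n * ℓ)).sup
    (fun k => max (s.arr 1 k / s.arr 0 k + 1) (s.arr 3 k / s.arr 2 k + 1)) := ⟨_, rfl⟩
  obtain ⟨D, hD⟩ : ∃ D, D = ∏ k ∈ range (n * ℓ), s.arr 1 k := ⟨_, rfl⟩
  obtain ⟨A, hA⟩ : ∃ A : ℕ → ℕ, ∀ k, A k =
    RAM.entryMass D (s.arr 0 k) (s.arr 1 k) (s.arr 2 k) := ⟨_, fun _ => rfl⟩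
  obtain ⟨g, hg⟩ : ∃ g : ℕ → ℕ, ∀ k, g k =
    level m (s.arr 0 k * s.arr 3 k) (s.arr 2 k * s.arr 1 k * T) := ⟨_, fun _ => rfl⟩
  obtain ⟨G, hG⟩ : ∃ G, G = (range (n * ℓ)).sup g := ⟨_, rfl⟩
  obtain ⟨K, hK⟩ : ∃ K, K = n * G + 1 := ⟨_, rfl⟩
  obtain ⟨Y, hY⟩ : ∃ Y, Y = 3 * L + m := ⟨_, rfl⟩
  obtain ⟨Z, hZ⟩ : ∃ Z, Z = K + 2 * (Y * n) + Y * K + 2 * Y := ⟨_, rfl⟩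
  have hw0 : 0 < w := hw ▸ Nat.succ_pos _
  have hm0 : 0 < m := by rw [hm]; positivity
  have hNL : n * ℓ ≤ L := mul_le_inputLength P Q ε
  have hTmax : ∀ i x, (P i x).den / (P i x).num + 1 ≤ T ∧ (Q i x).den / (Q i x).num + 1 ≤ T := by
    intro i x
    have h := le_sup (f := fun k => max (s.arr 1 k / s.arr 0 k + 1) (s.arr 3 k / s.arr 2 k + 1))
      (mem_range.2 (mul_add_lt_mul i x))
    rw [← hT] at h
    simpa only [a0, a1, a2, a3, max_le_iff] using h
  have hT0 : 0 < T := lt_of_lt_of_le (Nat.succ_pos _) (hTmax ⟨0, hn⟩ ⟨0, hℓ⟩).1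
  have hPD : ∀ i x, (P i x).den ∣ D := fun i x => by
    rw [hD, ← a1 i x]
    exact dvd_prod_of_mem _ (mem_range.2 (mul_add_lt_mul i x))
  have hD0 : 0 < D := by
    rw [hD]
    refine prod_pos fun k hk => ?_
    obtain ⟨i, x, rfl⟩ := exists_eq_of_lt_mul (mem_range.1 hk)
    rw [a1]
    exact (P i x).den_pos
  have hGle : G ≤ m * (2 * T.size) := by
    rw [hG]
    refine Finset.sup_le fun k hk => ?_
    obtain ⟨i, x, rfl⟩ := exists_eq_of_lt_mul (mem_range.1 hk)
    rw [hg, a0, a1, a2, a3]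
    exact level_le_of_probability hm0 (hQ1 i x) (hTmax i x).1
  have hsize : ε.num.size ≤ L ∧ ε.den.size ≤ L := by
    rw [hL, inputLength]
    omega
  obtain ⟨hTL, s', t, b, hexec, ht, hb, -, ho, hden⟩ := RAM.similarity_runs_of_length hn hℓ
    (s := s) (n := n) (ℓ := ℓ) (en := ε.num) (ed := ε.den) (N := n * ℓ) (L := L) rfl rfl rfl rfl
    (fun v hv => by obtain ⟨v, rfl⟩ := Nat.exists_eq_add_of_le' hv; rfl) rfl (hw ▸ hm) rfl hT hD hA
    hg (hG ▸ hK) (inputStore_arr_lt P Q ε) (Nat.size_le.1 hsize.1) (Nat.size_le.1 hsize.2)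
    (sum_size_den_le P Q ε) hNL hY hZ
  obtain ⟨hlow, hupp⟩ := output_bounds hm0 hT0 hD0 P Q (A := A) (g := g) (K := K)
    (fun i x => by rw [hA, a0, a1, a2]) (fun i x => by rw [hg, a0, a1, a2, a3]) hPD
    (fun i x h => (hP1 i x).trans (one_le_mul_of_div_add_one_le h (hTmax i x).2))
    (fun y => by
      rw [hK, Nat.lt_succ_iff]
      refine (sum_le_card_nsmul _ _ G fun i _ => ?_).trans (by simp)
      rw [hG]
      exact le_sup (mem_range.2 (mul_add_lt_mul i (y i)))) ho
  have hout : outputValue s' = (s'.var 0 : ℚ≥0) / ((D * T) ^ n * m ^ K : ℕ) := by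
    rw [outputValue, hden]
  have hεw : 1 ≤ ε * w := one_le_mul_of_div_add_one_le hε.ne' hw.ge
  rw [← hout] at hlow hupp
  have hεR : (0 : ℝ) < ε := by exact_mod_cast hε
  have hwR : (w : ℝ) ≤ 1 / (ε : ℝ) + 1 := by
    have e : (ε : ℝ) = ε.num / ε.den := by
      conv_lhs => rw [← NNRat.num_div_den ε]
      push_cast
      rfl
    rw [hw, e, one_div_div]
    push_cast
    linarith [Nat.cast_div_le (m := ε.den) (n := ε.num) (α := ℝ)]
  refine ⟨s', t, b, hexec, ?_, ?_, ?_, ?_, fun τ hτ hPτ hQτ => ?_⟩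
  · rw [hden]
    positivity
  · rw [div_le_iff₀' (by positivity)]
    refine hupp.trans (mul_le_mul_of_nonneg_right ?_ zero_le)
    refine (add_one_div_pow_le hn hw0 hm).trans ?_
    gcongr
    rwa [div_le_iff₀ (by positivity)]
  · exact hlow.trans (le_mul_of_one_le_left zero_le (le_add_of_nonneg_right zero_le))
  · have h1ε : 0 ≤ 1 / (ε : ℝ) := by positivity
    have hL1 : (1 : ℝ) ≤ L := by exact_mod_cast (Nat.mul_pos hn hℓ).trans_le hNL
    exact_mod_cast bit_cost_bound (x := (L : ℝ) + 1 / (ε : ℝ)) (by linarith) (by linarith)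
      ((Nat.le_mul_of_pos_right _ hℓ).trans hNL) hNL (by linarith) hm
      (Nat.size_le.2 (hTL.trans_lt (Nat.pow_lt_pow_right (by norm_num) (by omega)))) hGle hK hY hZ
      ht hb
  -- Some `P` probability in the first row is nonzero because the row sums to `1`, and it lies
  -- between `τ` and `1`.
  · have hτ1 : τ ≤ 1 := by
      obtain ⟨x, -, hx⟩ : ∃ x ∈ univ, P ⟨0, hn⟩ x ≠ 0 :=
        exists_ne_zero_of_sum_ne_zero (by rw [hP]; exact one_ne_zero)
      exact (hPτ _ x hx).trans (by exact_mod_cast hP1 _ x)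
    have hTτ : (T : ℝ) ≤ 2 / τ := by
      -- Passing to the floor keeps the bound in `ℕ`, where the supremum defining `T` lives.
      refine (Nat.le_floor_iff (by positivity)).1 ?_
      rw [hT]
      refine Finset.sup_le fun k hk => ?_
      obtain ⟨i, x, rfl⟩ := exists_eq_of_lt_mul (mem_range.1 hk)
      rw [a0, a1, a2, a3]
      exact max_le (Nat.le_floor (natCast_div_add_one_le hτ hτ1 (hPτ i x)))
        (Nat.le_floor (natCast_div_add_one_le hτ hτ1 (hQτ i x)))
    have he : 0 < min (ε : ℝ) 1 := lt_min hεR one_pos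
    have hwe : (w : ℝ) ≤ 2 / min (ε : ℝ) 1 := by
      have h1 : 1 / (ε : ℝ) ≤ 1 / min (ε : ℝ) 1 := one_div_le_one_div_of_le he (min_le_left _ _)
      have h2 : 1 / 1 ≤ 1 / min (ε : ℝ) 1 := one_div_le_one_div_of_le he (min_le_right _ _)
      have h3 : 2 / min (ε : ℝ) 1 = 1 / min (ε : ℝ) 1 + 1 / min (ε : ℝ) 1 := by ring
      linarith
    exact_mod_cast time_bound hn hℓ hT0 he (min_le_right _ _) hτ hτ1 hTτ hwe hm hGle hK ht
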